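/- **Setting.** Let $\mathcal{F}$ be a signature and $V$ an infinite set of variables. A TRS over $\mathcal{F}$ is a finite set of rewrite rules $l \to r$ such that $l$ is not a variable; $r$ may contain variables that do not occur in $l$. It is *left-linear* (*right-linear*) if no variable occurs twice in a left-hand (right-hand) side, and *growing* if, for every rule $l\to r$, the variables in $\mathrm{Var}(l)\cap \mathrm{Var}(r)$ occur only at depth $1$ in $l$. A term is a *redex* of $\mathcal{R}$ if it is an instance of a left-hand side; a ground term is *root-stable* for $\mathcal{R}$ if it does not rewrite ($\to_{\mathcal{R}}^*$) to a redex, and $\mathsf{RS}_{\mathcal{R}}$ is the set of these terms. Let $\mathcal{G}=\mathcal{F}\cup\{f^\circ\mid f\in\mathcal{F}\}$ with $f^\circ$ of the same arity as $f$; for $t=f(t_1,\dots,t_n)$ put $t^\circ=f^\circ(t_1,\dots,t_n)$, and for a TRS $\mathcal{S}$ over $\mathcal{F}$ put $\mathcal{S}^\circ=\mathcal{S}\cup\{l^\circ\to r\mid l\to r\in\mathcal{S}\}$, a TRS over $\mathcal{G}$. **Approximations.** $\mathcal{R}_{\mathrm s}$ is obtained from $\mathcal{R}$ by replacing every right-hand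 side by a variable not occurring in the corresponding left-hand side; $\mathcal{R}_{\mathrm{nv}}$ by replacing the variable occurrences in every right-hand side by pairwise distinct variables not occurring in the corresponding left-hand side; $\mathcal{R}_{\mathrm g}$ is any right-linear growing TRS obtained by replacing some variable occurrences in the right-hand sides by variables not occurring in the corresponding left-hand sides. For $\alpha\in\{\mathrm s,\mathrm{nv},\mathrm g\}$, a mapping that assigns to every $\mathcal{R}$ one such TRS $\mathcal{R}_\alpha$ is fixed; likewise for $\beta$. **Root-neededness.** For TRSs $\mathcal{R},\mathcal{S}$ over $\mathcal{F}$, a redex $\Delta$ of $\mathcal{R}$ in a ground term $C[\Delta]$ over $\mathcal{F}$ is $(\mathcal{R},\mathcal{S})$-*root-needed* if there is no $t\in\mathsf{RS}_{\mathcal{S}^\circ}$ with $C[\Delta^\circ]\to_{\mathcal{R}}^* t$. The class $\mathsf{CBN\text{-}RS}_{\alpha,\beta}$ consists of the TRSs $\mathcal{R}$ such that every ground term over $\mathcal{F}$ that is not root-stable for $\mathcal{R}_\beta$ has an $(\mathcal{R}_\alpha,\mathcal{R}_\beta)$-root-needed redex. **Automata.** Automata are finite bottom-up tree automata without $\epsilon$-transitions.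 For a TRS $\mathcal{R}$, let $S_{\mathcal{R}}$ be the set of all subterms of arguments of left-hand sides of $\mathcal{R}$, and let $[t]$ be the class of $t$ modulo variable renaming. For a TRS $\mathcal{R}$, viewed over the signature $\mathcal{G}$: 1. $\mathcal{B}(\mathcal{R})$ has the states $[t]$ ($t\in S_{\mathcal{R}}$) and $[x]$ ($x$ a variable), no final states, and the rules $f([t_1],\dots,[t_n])\to[t]$ for $t=f(t_1,\dots,t_n)\in S_{\mathcal{R}}$ and $f([x],\dots,[x])\to[x]$ for all $f\in\mathcal{G}$. 2. *Saturation* by $\mathcal{R}$ of an automaton that contains $\mathcal{B}(\mathcal{R})$ replaces its set of transition rules by the least set $\Gamma$ containing it such that, whenever $f(l_1,\dots,l_n)\to r\in\mathcal{R}$, $\theta$ maps the variables of $r$ to states and $r\theta\to_\Gamma^* q$, the rule $f(q_1,\dots,q_n)\to q$ is in $\Gamma$, where $q_i=l_i\theta$ if $l_i\in\mathrm{Var}(r)$ and $q_i=[l_i]$ otherwise. 3. $\mathcal{C}_{\mathsf{REDEX}_{\mathcal{R}}}(\mathcal{R})$ is the saturation by $\mathcal{R}$ of the automaton obtained from $\mathcal{B}(\mathcal{R})$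 by adding a single final state $q_f$ and the rules $f([l_1],\dots,[l_n])\to q_f$ for all left-hand sides $f(l_1,\dots,l_n)$ of $\mathcal{R}$. 4. $\mathcal{A}_{\mathsf{RS}_{\mathcal{S}^\circ}}$ is the subset automaton of $\mathcal{C}_{\mathsf{REDEX}_{\mathcal{S}^\circ}}(\mathcal{S}^\circ)$, restricted to its accessible states; the final states are the sets that do not contain $q_f$. 5. $\mathcal{C}_{\mathsf{RS}_{\mathcal{S}^\circ}}(\mathcal{R})$ is the saturation by $\mathcal{R}$ of the disjoint union of $\mathcal{A}_{\mathsf{RS}_{\mathcal{S}^\circ}}$ and $\mathcal{B}(\mathcal{R})$; $Q_f$ is its set of final states. 6. $\mathcal{C}'$ is the disjoint union of $\mathcal{C}_{\mathsf{RS}_{\mathcal{S}^\circ}}(\mathcal{R})$, a fresh copy of $\mathcal{B}(\mathcal{R})$ with states written $[t]'$, and $\mathcal{C}_{\mathsf{REDEX}_{\mathcal{S}}}(\mathcal{S})$; $Q_f'$ is the set of final states of the latter. For a symbol $f$ and sets $S_1,\dots,S_n$ of states of $\mathcal{C}'$, let $f(S_1,\dots,S_n){\downarrow}$ be the set of all states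 $q$ such that $f(q_1,\dots,q_n)\to q$ is a rule of $\mathcal{C}'$ for some $q_i\in S_i$. 7. $\mathcal{D}'(\mathcal{R},\mathcal{S})$ is the automaton over $\mathcal{F}$ whose states are all pairs $[S,P]$ of sets of states of $\mathcal{C}'$, whose final states are those $[S,P]$ with $S\cap Q_f'\neq\varnothing$ and $P\subseteq Q_f$, and whose rules are all $f([S_1,P_1],\dots,[S_n,P_n])\to[S,P^1\cup P^2]$ with $f\in\mathcal{F}$ such that $S=f(S_1,\dots,S_n){\downarrow}$; $P^1\subseteq\bigcup_{i=1}^n f(S_1,\dots,P_i,\dots,S_n){\downarrow}$; $P^1\cap f(S_1,\dots,\{q_i\},\dots,S_n){\downarrow}\neq\varnothing$ for all $i$ and all $q_i\in P_i$; and $P^2$ is a non-empty subset of $f^\circ(S_1,\dots,S_n){\downarrow}$ if $\mathcal{R}$ has a rule with left-hand side $f(l_1,\dots,l_n)$ such that $[l_i]'\in S_i$ for all $i$, and $P^2=\varnothing$ otherwise. **Theorem.** Let $\mathcal{R}$ be a left-linear TRS and $\alpha,\beta\in\{\mathrm s,\mathrm{nv},\mathrm g\}$. Then $\mathcal{R}\in\mathsf{CBN\text{-}RS}_{\alpha,\beta}$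 if and only if $L(\mathcal{D}'(\mathcal{R}_\alpha,\mathcal{R}_\beta))=\varnothing$. -/

import Mathlib

universe u v w

namespace CallByNeed


/-! ## Terms

A signature is a `FirstOrder.Language`, whose function symbols of arity `n` are `L.Functions n`
(its relation symbols play no role).  `L.Term V` is the set of terms with variables in `V`, and
`L.Term Empty` is the set of ground terms. -/

section Terms

variable {L : FirstOrder.Language.{u, v}} {V : Type w}

/-- The variables that occur in a term. -/
def vars : L.Term V → Set V
  | .var x => {x}
  | .func _ ts => ⋃ i, vars (ts i)

/-- The subterms of a term (the term itself included). -/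
def subterms : L.Term V → Set (L.Term V)
  | .var x => {.var x}
  | .func f ts => insert (.func f ts) (⋃ i, subterms (ts i))

/-- A term is linear if no variable occurs more than once in it. -/
def LinearTerm : L.Term V → Prop
  | .var _ => True
  | .func _ ts => (∀ i, LinearTerm (ts i)) ∧ ∀ i j, i ≠ j → Disjoint (vars (ts i)) (vars (ts j))

/-- One-hole contexts.  `cons f ts i C` is the context `f(t₁, …, C, …, tₙ)` with `C` as its `i`-th
argument; the `i`-th entry of `ts` is not used. -/
inductive Context (L : FirstOrder.Language.{u, v}) (V : Type w) : Type (max u w)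
  | hole : Context L V
  | cons {n : ℕ} (f : L.Functions n) (ts : Fin n → L.Term V) (i : Fin n) (C : Context L V) :
      Context L V

/-- `C.fill t` is `C[t]`. -/
def Context.fill : Context L V → L.Term V → L.Term V
  | .hole, t => t
  | .cons f ts i C, t => .func f (Function.update ts i (C.fill t))

end Terms

/-! ## Rewriting -/

/-- A rewrite rule `l → r`, where `l = root(args₁, …, argsₙ)` is not a variable.  The right-hand
side may contain variables that do not occur in the left-hand side. -/
structure Rule (L : FirstOrder.Language.{u, v}) (V : Type w) where
  arity : ℕ
  root : L.Functions arity
  args : Fin arity → L.Term V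
  rhs : L.Term V

/-- The left-hand side of a rule. -/
def Rule.lhs {L : FirstOrder.Language.{u, v}} {V : Type w} (ρ : Rule L V) : L.Term V := .func ρ.root ρ.args

/-- A term rewriting system: a finite set of rewrite rules. -/
structure TRS (L : FirstOrder.Language.{u, v}) (V : Type w) where
  rules : Set (Rule L V)
  finite_rules : rules.Finite

section Rewriting

variable {L : FirstOrder.Language.{u, v}} {V : Type w}

/-- The one-step rewrite relation of `R` on the terms with variables in `X`. -/
inductive Rewrites (R : TRS L V) {X : Type*} : L.Term X → L.Term X → Prop
  | root (ρ : Rule L V) (hρ : ρ ∈ R.rules) (σ : V → L.Term X) :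
      Rewrites R (ρ.lhs.subst σ) (ρ.rhs.subst σ)
  | arg {n : ℕ} (f : L.Functions n) (ts : Fin n → L.Term X) (i : Fin n) (u : L.Term X)
      (h : Rewrites R (ts i) u) :
      Rewrites R (.func f ts) (.func f (Function.update ts i u))

/-- `s →* t`. -/
def RewritesStar (R : TRS L V) {X : Type*} : L.Term X → L.Term X → Prop :=
  Relation.ReflTransGen (Rewrites R)

/-- `t` is a redex: an instance of a left-hand side. -/
def IsRedex (R : TRS L V) {X : Type*} (t : L.Term X) : Prop :=
  ∃ ρ ∈ R.rules, ∃ σ : V → L.Term X, t = ρ.lhs.subst σ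

/-- `t` is root-stable: it does not rewrite to a redex. -/
def RootStable (R : TRS L V) {X : Type*} (t : L.Term X) : Prop :=
  ¬ ∃ u, RewritesStar R t u ∧ IsRedex R u

def TRS.LeftLinear (R : TRS L V) : Prop := ∀ ρ ∈ R.rules, LinearTerm ρ.lhs

def TRS.RightLinear (R : TRS L V) : Prop := ∀ ρ ∈ R.rules, LinearTerm ρ.rhs

/-- `R` is growing: the variables common to both sides of a rule occur only at depth one in the
left-hand side. -/
def TRS.Growing (R : TRS L V) : Prop :=
  ∀ ρ ∈ R.rules, ∀ x ∈ vars ρ.rhs, ∀ i, x ∈ vars (ρ.args i) → ρ.args i = .var x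

/-! ## Approximations -/

/-- `ReplacesVars W r r'`: the term `r'` is obtained from `r` by replacing some (possibly all,
possibly no) occurrences of variables by variables that are not in `W`. -/
inductive ReplacesVars (W : Set V) : L.Term V → L.Term V → Prop
  | keep (x : V) : ReplacesVars W (.var x) (.var x)
  | replace (x y : V) (hy : y ∉ W) : ReplacesVars W (.var x) (.var y)
  | func {n : ℕ} (f : L.Functions n) (ts us : Fin n → L.Term V)
      (h : ∀ i, ReplacesVars W (ts i) (us i)) : ReplacesVars W (.func f ts) (.func f us)

/-- The three kinds of approximations. -/
inductive Kind
  | s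
  | nv
  | g

/-- `r'` may replace the right-hand side of the rule `ρ` in an approximation of the given kind. -/
def ApproximatesRhs (ρ : Rule L V) (r' : L.Term V) : Kind → Prop
  | .s => ∃ x, x ∉ vars ρ.lhs ∧ r' = .var x
  | .nv => ReplacesVars (vars ρ.lhs) ρ.rhs r' ∧ LinearTerm r' ∧ Disjoint (vars r') (vars ρ.lhs)
  | .g => ReplacesVars (vars ρ.lhs) ρ.rhs r'

/-- `R'` is an approximation of `R` of the given kind: it is obtained from `R` by changing the
right-hand side of every rule as described by `ApproximatesRhs`; for the kind `g` it must moreover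
be right-linear and growing. -/
def IsApproximation (k : Kind) (R R' : TRS L V) : Prop :=
  (∃ φ : Rule L V → L.Term V,
    (∀ ρ ∈ R.rules, ApproximatesRhs ρ (φ ρ) k) ∧
    R'.rules = (fun ρ => { ρ with rhs := φ ρ }) '' R.rules) ∧
  (k = .g → R'.RightLinear ∧ R'.Growing)

/-- `α` is an approximation mapping of the given kind. -/
def IsApproximationMapping (k : Kind) (α : TRS L V → TRS L V) : Prop :=
  ∀ R, IsApproximation k R (α R)

end Rewriting

/-! ## Marked symbols and root-neededness -/

/-- The signature `F ∪ {f° | f ∈ F}`: `Sum.inl f` is `f` and `Sum.inr f` is `f°`. -/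
abbrev Marked (L : FirstOrder.Language.{u, v}) : FirstOrder.Language.{u, v} := L.sum L

section Marking

variable {L : FirstOrder.Language.{u, v}} {V : Type w}

/-- The inclusion of the terms over `F` into the terms over `F ∪ {f° | f ∈ F}`. -/
def plain (t : L.Term V) : (Marked L).Term V := FirstOrder.Language.LHom.sumInl.onTerm t

/-- `t°`: the root symbol of `t` is marked. -/
def markRoot : L.Term V → (Marked L).Term V
  | .var x => .var x
  | .func f ts => .func (Sum.inr f) (fun i => plain (ts i))

/-- The inclusion of the contexts over `F` into the contexts over `F ∪ {f° | f ∈ F}`. -/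
def Context.plain : Context L V → Context (Marked L) V
  | .hole => .hole
  | .cons f ts i C => .cons (Sum.inl f) (fun j => CallByNeed.plain (ts j)) i C.plain

/-- The rule `l → r` over the larger signature. -/
def Rule.plain (ρ : Rule L V) : Rule (Marked L) V :=
  ⟨ρ.arity, Sum.inl ρ.root, fun i => CallByNeed.plain (ρ.args i), CallByNeed.plain ρ.rhs⟩

/-- The rule `l° → r`. -/
def Rule.mark (ρ : Rule L V) : Rule (Marked L) V :=
  ⟨ρ.arity, Sum.inr ρ.root, fun i => CallByNeed.plain (ρ.args i), CallByNeed.plain ρ.rhs⟩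

/-- The TRS `R` over the larger signature. -/
def TRS.plain (R : TRS L V) : TRS (Marked L) V :=
  ⟨Rule.plain '' R.rules, R.finite_rules.image _⟩

/-- `R° = R ∪ {l° → r | l → r ∈ R}`. -/
def TRS.circ (R : TRS L V) : TRS (Marked L) V :=
  ⟨Rule.plain '' R.rules ∪ Rule.mark '' R.rules,
    (R.finite_rules.image _).union (R.finite_rules.image _)⟩

/-- The redex `Δ` in the ground term `C[Δ]` is `(R, S)`-root-needed: there is no ground term `t`
that is root-stable with respect to `S°` such that `C[Δ°] →* t` in `R`. -/
def IsRootNeededRedex (R S : TRS L V) (C : Context L Empty) (Δ : L.Term Empty) : Prop :=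
  IsRedex R Δ ∧
    ¬ ∃ t : (Marked L).Term Empty,
      RootStable S.circ t ∧ RewritesStar R.plain (C.plain.fill (markRoot Δ)) t

/-- The class `CBN-RS` for the approximation mappings `α` and `β`: every ground term that is not
root-stable with respect to `β R` has an `(α R, β R)`-root-needed redex. -/
def CBNRS (α β : TRS L V → TRS L V) : Set (TRS L V) :=
  {R | ∀ s : L.Term Empty, ¬ RootStable (β R) s →
    ∃ (C : Context L Empty) (Δ : L.Term Empty),
      s = C.fill Δ ∧ IsRootNeededRedex (α R) (β R) C Δ}

end Marking

/-! ## Tree automata -/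

/-- A transition rule `symbol(args₁, …, argsₙ) → target`. -/
structure Transition (L : FirstOrder.Language.{u, v}) (Q : Type w) where
  arity : ℕ
  symbol : L.Functions arity
  args : Fin arity → Q
  target : Q

/-- All states of the transition rule are in `Q₀`. -/
def Transition.Over {L : FirstOrder.Language.{u, v}} {Q : Type w} (τ : Transition L Q) (Q₀ : Set Q) : Prop :=
  (∀ i, τ.args i ∈ Q₀) ∧ τ.target ∈ Q₀

/-- A finite bottom-up tree automaton without `ε`-transitions, with states taken from `Q`. -/
structure TreeAutomaton (L : FirstOrder.Language.{u, v}) (Q : Type w) where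
  states : Set Q
  finite_states : states.Finite
  final : Set Q
  final_subset : final ⊆ states
  rules : Set (Transition L Q)
  rules_over : ∀ τ ∈ rules, τ.Over states

section Automata

variable {L : FirstOrder.Language.{u, v}} {Q : Type*} {Q' : Type*}

/-- `Reaches Γ θ t q` means `tθ →* q` with the transition rules `Γ`, where `tθ` is the term `t`
with its variables replaced by states according to `θ`. -/
inductive Reaches (Γ : Set (Transition L Q)) {X : Type*} (θ : X → Q) : L.Term X → Q → Prop
  | var (x : X) : Reaches Γ θ (.var x) (θ x)
  | func {n : ℕ} (f : L.Functions n) (ts : Fin n → L.Term X) (qs : Fin n → Q) (q : Q)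
      (hts : ∀ i, Reaches Γ θ (ts i) (qs i)) (hf : ⟨n, f, qs, q⟩ ∈ Γ) :
      Reaches Γ θ (.func f ts) q

/-- `t →* q` for a ground term `t`. -/
def GroundReaches (Γ : Set (Transition L Q)) (t : L.Term Empty) (q : Q) : Prop :=
  Reaches Γ Empty.elim t q

/-- The set of states `q` such that `f(q₁, …, qₙ) → q` is a rule in `Γ` for some `qᵢ ∈ Sᵢ`;
this is `f(S₁, …, Sₙ)↓`. -/
def down (Γ : Set (Transition L Q)) {n : ℕ} (f : L.Functions n) (S : Fin n → Set Q) : Set Q :=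
  {q | ∃ qs : Fin n → Q, (∀ i, qs i ∈ S i) ∧ ⟨n, f, qs, q⟩ ∈ Γ}

namespace TreeAutomaton

/-- The language of an automaton: the ground terms that reach a final state. -/
def language (A : TreeAutomaton L Q) : Set (L.Term Empty) :=
  {t | ∃ q ∈ A.final, GroundReaches A.rules t q}

theorem down_subset (A : TreeAutomaton L Q) {n : ℕ} (f : L.Functions n) (S : Fin n → Set Q) :
    down A.rules f S ⊆ A.states := by
  rintro q ⟨qs, -, h⟩
  exact (A.rules_over _ h).2

/-- Renaming of states. -/
def map (g : Q → Q') (A : TreeAutomaton L Q) : TreeAutomaton L Q' where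
  states := g '' A.states
  finite_states := A.finite_states.image g
  final := g '' A.final
  final_subset := Set.image_mono A.final_subset
  rules := (fun τ => ⟨τ.arity, τ.symbol, fun i => g (τ.args i), g τ.target⟩) '' A.rules
  rules_over := by
    rintro _ ⟨τ, hτ, rfl⟩
    exact ⟨fun i => ⟨_, (A.rules_over τ hτ).1 i, rfl⟩, ⟨_, (A.rules_over τ hτ).2, rfl⟩⟩

/-- The union of two automata. -/
def union (A B : TreeAutomaton L Q) : TreeAutomaton L Q where
  states := A.states ∪ B.states
  finite_states := A.finite_states.union B.finite_states
  final := A.final ∪ B.final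
  final_subset := Set.union_subset_union A.final_subset B.final_subset
  rules := A.rules ∪ B.rules
  rules_over := by
    rintro τ (h | h)
    · exact ⟨fun i => Or.inl ((A.rules_over τ h).1 i), Or.inl (A.rules_over τ h).2⟩
    · exact ⟨fun i => Or.inr ((B.rules_over τ h).1 i), Or.inr (B.rules_over τ h).2⟩

/-- The same automaton without final states. -/
def withoutFinal (A : TreeAutomaton L Q) : TreeAutomaton L Q where
  states := A.states
  finite_states := A.finite_states
  final := ∅
  final_subset := Set.empty_subset _
  rules := A.rules
  rules_over := A.rules_over

/-- The restriction of an automaton to its accessible states. -/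
def trim (A : TreeAutomaton L Q) : TreeAutomaton L Q where
  states := {q ∈ A.states | ∃ t, GroundReaches A.rules t q}
  finite_states := A.finite_states.subset (Set.sep_subset _ _)
  final := {q ∈ A.final | ∃ t, GroundReaches A.rules t q}
  final_subset := fun _ hq => ⟨A.final_subset hq.1, hq.2⟩
  rules := {τ ∈ A.rules | τ.Over {q ∈ A.states | ∃ t, GroundReaches A.rules t q}}
  rules_over := fun _ hτ => hτ.2

/-- The subset construction for the complement: after reading a term, the state is the set of
the states of `A` that the term reaches, and the final states are the sets without final states
of `A`. -/
def complement (A : TreeAutomaton L Q) : TreeAutomaton L (Set Q) where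
  states := {X | X ⊆ A.states}
  finite_states := A.finite_states.finite_subsets
  final := {X | X ⊆ A.states ∧ Disjoint X A.final}
  final_subset := fun _ hX => hX.1
  rules := {τ | (∀ i, τ.args i ⊆ A.states) ∧ τ.target = down A.rules τ.symbol τ.args}
  rules_over := fun _ hτ => ⟨hτ.1, hτ.2 ▸ A.down_subset _ _⟩

end TreeAutomaton

end Automata

/-! ## The matching automaton -/

section Matching

variable {L : FirstOrder.Language.{u, v}} {V : Type w}

/-- Literal similarity: equality up to a renaming of variables. -/
def similarity (L : FirstOrder.Language.{u, v}) (V : Type w) : Setoid (L.Term V) where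
  r s t := ∃ π : Equiv.Perm V, t = s.relabel π
  iseqv :=
    { refl := fun t => ⟨Equiv.refl V, by simp⟩
      symm := by
        rintro s t ⟨π, rfl⟩
        exact ⟨π.symm, by rw [FirstOrder.Language.Term.relabel_relabel]; simp⟩
      trans := by
        rintro s t r ⟨π, rfl⟩ ⟨π', rfl⟩
        exact ⟨π.trans π', by rw [FirstOrder.Language.Term.relabel_relabel]; rfl⟩ }

/-- The equivalence classes of terms with respect to literal similarity. -/
abbrev TermClass (L : FirstOrder.Language.{u, v}) (V : Type w) : Type (max u w) := Quotient (similarity L V)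

/-- The equivalence class `[t]`. -/
def cls (t : L.Term V) : TermClass L V := Quotient.mk (similarity L V) t

theorem cls_var (x y : V) : cls (.var x : L.Term V) = cls (.var y) := by
  classical
  exact Quotient.sound ⟨Equiv.swap x y, by simp [FirstOrder.Language.Term.relabel]⟩

/-- The set of all subterms of the arguments of the left-hand sides of `R`. -/
def argSubterms (R : TRS L V) : Set (L.Term V) :=
  {t | ∃ ρ ∈ R.rules, ∃ i, t ∈ subterms (ρ.args i)}

theorem self_mem_subterms (t : L.Term V) : t ∈ subterms t := by
  cases t <;> simp [subterms]

theorem finite_subterms (t : L.Term V) : (subterms t).Finite := by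
  induction t with
  | var x => simp [subterms]
  | func f ts ih => exact (Set.finite_iUnion ih).insert _

theorem subterms_trans {s t u : L.Term V} (hs : s ∈ subterms t) (ht : t ∈ subterms u) :
    s ∈ subterms u := by
  induction u with
  | var x =>
    simp only [subterms, Set.mem_singleton_iff] at ht
    subst ht
    exact hs
  | func f ts ih =>
    simp only [subterms, Set.mem_insert_iff, Set.mem_iUnion] at ht
    rcases ht with rfl | ⟨i, hi⟩
    · exact hs
    · exact Set.mem_insert_of_mem _ (Set.mem_iUnion.2 ⟨i, ih i hi⟩)

theorem finite_argSubterms (R : TRS L V) : (argSubterms R).Finite := by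
  have h : argSubterms R = ⋃ ρ ∈ R.rules, ⋃ i, subterms (ρ.args i) := by
    ext t
    simp [argSubterms]
  rw [h]
  exact R.finite_rules.biUnion fun ρ _ => Set.finite_iUnion fun i => finite_subterms _

theorem arg_mem_argSubterms (R : TRS L V) {n : ℕ} {f : L.Functions n} {ts : Fin n → L.Term V}
    (h : .func f ts ∈ argSubterms R) (i : Fin n) : ts i ∈ argSubterms R := by
  obtain ⟨ρ, hρ, j, hj⟩ := h
  refine ⟨ρ, hρ, j, subterms_trans ?_ hj⟩
  exact Set.mem_insert_of_mem _ (Set.mem_iUnion.2 ⟨i, self_mem_subterms _⟩)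

/-- The automaton `B(R)`: its states are `[x]` and `[t]` for the subterms `t` of arguments of
left-hand sides; it has the matching rules `f([t₁], …, [tₙ]) → [t]` for all such
`t = f(t₁, …, tₙ)` and the propagation rules `f([x], …, [x]) → [x]` for all symbols `f`. -/
def matchingAutomaton (R : TRS L V) : TreeAutomaton L (TermClass L V) where
  states := cls '' argSubterms R ∪ Set.range fun x : V => cls (.var x)
  finite_states := by
    refine ((finite_argSubterms R).image _).union (Set.Subsingleton.finite ?_)
    rintro _ ⟨x, rfl⟩ _ ⟨y, rfl⟩
    exact cls_var x y
  final := ∅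
  final_subset := Set.empty_subset _
  rules :=
    {τ | ∃ (n : ℕ) (f : L.Functions n) (ts : Fin n → L.Term V),
      .func f ts ∈ argSubterms R ∧ τ = ⟨n, f, fun i => cls (ts i), cls (.func f ts)⟩} ∪
    {τ | ∃ (n : ℕ) (f : L.Functions n) (x : V),
      τ = ⟨n, f, fun _ => cls (.var x), cls (.var x)⟩}
  rules_over := by
    rintro _ (⟨n, f, ts, h, rfl⟩ | ⟨n, f, x, rfl⟩)
    · exact ⟨fun i => Or.inl ⟨_, arg_mem_argSubterms R h i, rfl⟩, Or.inl ⟨_, h, rfl⟩⟩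
    · exact ⟨fun i => Or.inr ⟨x, rfl⟩, Or.inr ⟨x, rfl⟩⟩

theorem cls_arg_mem (R : TRS L V) {ρ : Rule L V} (hρ : ρ ∈ R.rules) (i : Fin ρ.arity) :
    cls (ρ.args i) ∈ (matchingAutomaton R).states :=
  Or.inl ⟨_, ⟨ρ, hρ, i, self_mem_subterms _⟩, rfl⟩

end Matching

/-! ## Saturation -/

section Saturation

variable {L : FirstOrder.Language.{u, v}} {V : Type w} {Q : Type*}

open Classical in
/-- The state at the argument `t` of the left-hand side of a rule with right-hand side `r` in the
inferred transition rule: it is `tθ` if `t` is a variable of `r`, and `[t]` otherwise.  Here `ι`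
embeds the states `[t]` into `Q`. -/
noncomputable def argState (ι : TermClass L V → Q) (r : L.Term V) (θ : V → Q) : L.Term V → Q
  | .var x => if x ∈ vars r then θ x else ι (cls (.var x))
  | .func f ts => ι (cls (.func f ts))

/-- `Γ` is closed under the inference rule: for every rewrite rule `f(l₁, …, lₙ) → r` of `R` and
every mapping `θ` from the variables of `r` to states, if `rθ →* q` with rules in `Γ` then
`f(q₁, …, qₙ) → q` is in `Γ`, where `qᵢ = lᵢθ` if `lᵢ` is a variable of `r` and `qᵢ = [lᵢ]`
otherwise. -/
def InferenceClosed (R : TRS L V) (ι : TermClass L V → Q) (states : Set Q)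
    (Γ : Set (Transition L Q)) : Prop :=
  ∀ ρ ∈ R.rules, ∀ θ : V → Q, (∀ x ∈ vars ρ.rhs, θ x ∈ states) →
    ∀ q, Reaches Γ θ ρ.rhs q →
      ⟨ρ.arity, ρ.root, fun i => argState ι ρ.rhs θ (ρ.args i), q⟩ ∈ Γ

/-- The smallest set of transition rules that contains `Γ` and is closed under the inference
rule. -/
def saturation (R : TRS L V) (ι : TermClass L V → Q) (states : Set Q)
    (Γ : Set (Transition L Q)) : Set (Transition L Q) :=
  ⋂₀ {Γ' | Γ ⊆ Γ' ∧ InferenceClosed R ι states Γ'}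

theorem Reaches.mem_states {Γ : Set (Transition L Q)} {states : Set Q}
    (hΓ : ∀ τ ∈ Γ, τ.Over states) {X : Type*} {θ : X → Q} {t : L.Term X} {q : Q}
    (h : Reaches Γ θ t q) (hθ : ∀ x ∈ vars t, θ x ∈ states) : q ∈ states := by
  cases h with
  | var x => exact hθ x rfl
  | func f ts qs q hts hf => exact (hΓ _ hf).2

/-- The automaton obtained from `A`, which must have the states of `B(R)` among its states, by
saturating its transition rules. -/
def TreeAutomaton.saturate (A : TreeAutomaton L Q) (R : TRS L V) (ι : TermClass L V → Q)
    (hι : ∀ c ∈ (matchingAutomaton R).states, ι c ∈ A.states) : TreeAutomaton L Q where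
  states := A.states
  finite_states := A.finite_states
  final := A.final
  final_subset := A.final_subset
  rules := saturation R ι A.states A.rules
  rules_over := by
    intro τ hτ
    refine hτ {τ | τ.Over A.states} ⟨A.rules_over, ?_⟩
    intro ρ hρ θ hθ q hq
    refine ⟨fun i => ?_, hq.mem_states (fun τ h => h) hθ⟩
    have hi := hι _ (cls_arg_mem R hρ i)
    change argState ι ρ.rhs θ (ρ.args i) ∈ A.states
    generalize ρ.args i = t at hi
    cases t with
    | var x =>
      by_cases hx : x ∈ vars ρ.rhs
      · simpa [argState, hx] using hθ x hx
      · simpa [argState, hx] using hi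
    | func f ts => simpa [argState] using hi

/-- The automaton `C_T(R)` for an automaton `A` that recognizes `T`: the disjoint union of `A` and
`B(R)`, saturated. -/
def saturatedUnion (A : TreeAutomaton L Q) (R : TRS L V) : TreeAutomaton L (Q ⊕ TermClass L V) :=
  ((A.map Sum.inl).union ((matchingAutomaton R).map Sum.inr)).saturate R Sum.inr
    fun c hc => Or.inr ⟨c, hc, rfl⟩

/-- The automaton for the ground redexes of `S`: to `B(S)` one adds a single final state `q_f`
(which is `none`) and the rules `f([l₁], …, [lₙ]) → q_f` for all left-hand sides
`f(l₁, …, lₙ)`. -/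
def redexAutomaton (S : TRS L V) : TreeAutomaton L (Option (TermClass L V)) where
  states := insert none (some '' (matchingAutomaton S).states)
  finite_states := ((matchingAutomaton S).finite_states.image _).insert _
  final := {none}
  final_subset := Set.singleton_subset_iff.2 (Set.mem_insert _ _)
  rules := ((matchingAutomaton S).map some).rules ∪
    {τ | ∃ ρ ∈ S.rules, τ = ⟨ρ.arity, ρ.root, fun i => some (cls (ρ.args i)), none⟩}
  rules_over := by
    rintro τ (h | ⟨ρ, hρ, rfl⟩)
    · have := ((matchingAutomaton S).map some).rules_over τ h
      exact ⟨fun i => Or.inr (this.1 i), Or.inr this.2⟩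
    · exact ⟨fun i => Or.inr ⟨_, cls_arg_mem S hρ i, rfl⟩, Or.inl rfl⟩

/-- The automaton `C_REDEX(S)` for the ground terms that rewrite in `S` to a redex of `S`: the
union of the redex automaton and `B(S)` (which share the states of `B(S)`, so that this union is
the redex automaton itself), saturated. -/
def nonRootStableAutomaton (S : TRS L V) : TreeAutomaton L (Option (TermClass L V)) :=
  (redexAutomaton S).saturate S some fun c hc => Or.inr ⟨c, hc, rfl⟩

/-- The automaton for the root-stable ground terms of `S`; only accessible states are kept. -/
def rootStableAutomaton (S : TRS L V) : TreeAutomaton L (Set (Option (TermClass L V))) :=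
  (nonRootStableAutomaton S).complement.trim

end Saturation

/-! ## The automaton `D'(R, S)` -/

section FinalConstruction

variable {L : FirstOrder.Language.{u, v}} {V : Type w}

/-- The automaton `C_RS(R)` for the ground terms over `F ∪ {f° | f ∈ F}` that rewrite in `R` to a
root-stable term of `S°`. -/
def toRootStableAutomaton (R S : TRS L V) :
    TreeAutomaton (Marked L)
      (Set (Option (TermClass (Marked L) V)) ⊕ TermClass (Marked L) V) :=
  saturatedUnion (rootStableAutomaton S.circ) R.plain

/-- The states of `C'_RS(R)`: the states of `C_RS(R)`, the states of a fresh copy of `B(R)`, and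
the states of `C_REDEX(S)`. -/
abbrev StateC' (L : FirstOrder.Language.{u, v}) (V : Type w) : Type (max u w) :=
  (Set (Option (TermClass (Marked L) V)) ⊕ TermClass (Marked L) V) ⊕
    (TermClass (Marked L) V ⊕ Option (TermClass (Marked L) V))

/-- The state `[t]'` of the fresh copy of `B(R)`. -/
def fresh (t : (Marked L).Term V) : StateC' L V := Sum.inr (Sum.inl (cls t))

/-- The automaton `C'_RS(R)`: the union of `C_RS(R)`, a fresh copy of `B(R)`, and
`C_REDEX(S)`; its final states are those of `C_RS(R)`. -/
def automatonC' (R S : TRS L V) : TreeAutomaton (Marked L) (StateC' L V) :=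
  ((toRootStableAutomaton R S).map Sum.inl).union
    (((matchingAutomaton R.plain).map (Sum.inr ∘ Sum.inl)).union
      ((nonRootStableAutomaton S.plain).withoutFinal.map (Sum.inr ∘ Sum.inr)))

/-- The set `Q_f` of the final states of `C_RS(R)`. -/
def finalRS (R S : TRS L V) : Set (StateC' L V) := Sum.inl '' (toRootStableAutomaton R S).final

/-- The set `Q_f'` of the final states of `C_REDEX(S)`. -/
def finalREDEX (S : TRS L V) : Set (StateC' L V) :=
  (Sum.inr ∘ Sum.inr) '' (nonRootStableAutomaton S.plain).final

/-- There is a rule in `R` with left-hand side `f(l₁, …, lₙ)` such that `[lᵢ]' ∈ Sᵢ` for all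
`i`. -/
def MatchesLhs (R : TRS L V) {n : ℕ} (f : L.Functions n) (Ss : Fin n → Set (StateC' L V)) : Prop :=
  ∃ (l : Fin n → L.Term V) (r : L.Term V),
    (⟨n, f, l, r⟩ : Rule L V) ∈ R.rules ∧ ∀ i, fresh (plain (l i)) ∈ Ss i

/-- The transition rules `f([S₁, P₁], …, [Sₙ, Pₙ]) → [S, P]` of `D'(R, S)`, where
`S = f(S₁, …, Sₙ)↓` and `P = P¹ ∪ P²`. -/
inductive IsTransitionD' (R S : TRS L V) :
    Transition L (Set (StateC' L V) × Set (StateC' L V)) → Prop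
  | mk {n : ℕ} (f : L.Functions n) (Ss Ps : Fin n → Set (StateC' L V))
      (P₁ P₂ : Set (StateC' L V))
      (hSs : ∀ i, Ss i ⊆ (automatonC' R S).states)
      (hPs : ∀ i, Ps i ⊆ (automatonC' R S).states)
      (hP₁ : P₁ ⊆ ⋃ i, down (automatonC' R S).rules (Sum.inl f) (Function.update Ss i (Ps i)))
      (hP₁' : ∀ i, ∀ q ∈ Ps i,
        (P₁ ∩ down (automatonC' R S).rules (Sum.inl f) (Function.update Ss i {q})).Nonempty)
      (hP₂ : MatchesLhs R f Ss →
        P₂.Nonempty ∧ P₂ ⊆ down (automatonC' R S).rules (Sum.inr f) Ss)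
      (hP₂' : ¬ MatchesLhs R f Ss → P₂ = ∅) :
      IsTransitionD' R S
        ⟨n, f, fun i => (Ss i, Ps i),
          (down (automatonC' R S).rules (Sum.inl f) Ss, P₁ ∪ P₂)⟩

/-- The automaton `D'(R, S)` over the signature `F`: its states are all pairs `[S, P]` of sets of
states of `C'_RS(R)`, and `[S, P]` is final if `S ∩ Q_f' ≠ ∅` and `P ⊆ Q_f`. -/
def automatonD' (R S : TRS L V) :
    TreeAutomaton L (Set (StateC' L V) × Set (StateC' L V)) where
  states := {X | X ⊆ (automatonC' R S).states} ×ˢ {X | X ⊆ (automatonC' R S).states}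
  finite_states :=
    (automatonC' R S).finite_states.finite_subsets.prod
      (automatonC' R S).finite_states.finite_subsets
  final := {X | X.1 ⊆ (automatonC' R S).states ∧ (X.1 ∩ finalREDEX S).Nonempty ∧
    X.2 ⊆ finalRS R S}
  final_subset := by
    rintro ⟨X, Y⟩ ⟨hX, -, hY⟩
    refine ⟨hX, hY.trans ?_⟩
    exact (Set.image_mono (toRootStableAutomaton R S).final_subset).trans Set.subset_union_left
  rules := {τ | IsTransitionD' R S τ}
  rules_over := by
    rintro _ ⟨f, Ss, Ps, P₁, P₂, hSs, hPs, hP₁, hP₁', hP₂, hP₂'⟩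
    refine ⟨fun i => ⟨hSs i, hPs i⟩, (automatonC' R S).down_subset _ _, ?_⟩
    refine Set.union_subset (hP₁.trans (Set.iUnion_subset fun i => ?_)) ?_
    · exact (automatonC' R S).down_subset _ _
    · by_cases h : MatchesLhs R f Ss
      · exact (hP₂ h).2.trans ((automatonC' R S).down_subset _ _)
      · rw [hP₂' h]
        exact Set.empty_subset _

end FinalConstruction

end CallByNeed

/-!
The theorem holds because `D'(R, S)` accepts exactly the ground terms that are not root-stable for
`S` and in which no redex of `R` is root-needed (`mem_language_automatonD'_iff`), for all linear
growing `R` and `S`; the approximations of a left-linear system are of this form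
(`IsApproximation.linearGrowing`). A term in the language of `D'` is thus the same as a
counterexample to membership in `CBN-RS`.

The basis is the saturation theorem `groundReaches_saturate_iff`: a ground term reaches a state of
a saturated automaton iff it rewrites to a term that reaches this state before saturation.
Right-linearity gives completeness, since a run on an instance `rσ` of a right-hand side then
yields one state for each variable of `r`, and these states give an inferred transition rule.
For soundness, the transition rules that preserve the property "rewrites to a term that reaches the
state before saturation" contain the initial ones and are closed under the inference rule. Here
left-linearity makes the state `[t]` recognize precisely the instances of `t`, the growing condition
ensures that variables of `r` receive arguments that need no matching, and the variables of `r` that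
do not occur on the left are instantiated by ground terms that reach the prescribed states, which
exist because all states are accessible. Consequently `C_REDEX(S)` recognizes the terms that are not
root-stable for `S`, its subset automaton for `S°` recognizes the root-stable ones, and
`C_RS(R)` the terms that rewrite in `R` to a root-stable term of `S°`.

Contexts with a marked redex are handled through the inductive relation `MarksRedex`. In a state
`[S, P]` reached by a ground term `t`, the set `S` consists of all states of `C'` reached by `t`, and
marking any redex of `t` gives a term that reaches some state in `P`. Conversely, every `P` that
meets the reached states in this way, and contains only such states, occurs in a state reached by
`t`; the sets `Pᵢ` for the arguments collect the states at the `i`-th argument in runs that lead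
to `P`. Taking for `P` all final states of `C_RS(R)` that are reached after marking a redex yields an
accepting run as soon as no redex is root-needed.
-/

namespace CallByNeed

open FirstOrder.Language (LHom)

/-! ### Terms and substitutions -/

section Terms

variable {L : FirstOrder.Language.{u, v}} {V : Type w}

/-- Functions given on disjoint sets, and a default function off these sets, have a common
extension. -/
theorem exists_glue {ι X Y : Type*} (A : ι → Set X) (hA : ∀ i j, i ≠ j → Disjoint (A i) (A j))
    (g : ι → X → Y) (g₀ : X → Y) :
    ∃ h : X → Y, (∀ i, ∀ x ∈ A i, h x = g i x) ∧ ∀ x, (∀ i, x ∉ A i) → h x = g₀ x := by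
  classical
  refine ⟨fun x => if hx : ∃ i, x ∈ A i then g hx.choose x else g₀ x, fun i x hx => ?_,
    fun x hx => ?_⟩
  · have h : ∃ i, x ∈ A i := ⟨i, hx⟩
    have hi : h.choose = i := by
      by_contra hne
      exact Set.disjoint_left.1 (hA _ _ hne) h.choose_spec hx
    simp only [dif_pos h, hi]
  · have h : ¬ ∃ i, x ∈ A i := fun ⟨i, hi⟩ => hx i hi
    simp only [dif_neg h]

theorem subst_congr {X : Type*} {t : L.Term V} {σ τ : V → L.Term X}
    (h : ∀ x ∈ vars t, σ x = τ x) : t.subst σ = t.subst τ := by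
  induction t with
  | var x => exact h x rfl
  | func f ts ih =>
    simp only [FirstOrder.Language.Term.subst]
    congr 1
    funext i
    exact ih i fun x hx => h x (Set.mem_iUnion.2 ⟨i, hx⟩)

/-- Matching the arguments of a linear term separately suffices to match the whole term. -/
theorem exists_subst_of_linear {X : Type*} [Nonempty (L.Term X)] {n : ℕ} {ts : Fin n → L.Term V}
    (hts : ∀ i j, i ≠ j → Disjoint (vars (ts i)) (vars (ts j))) {ss : Fin n → L.Term X}
    (h : ∀ i, ∃ σ : V → L.Term X, ss i = (ts i).subst σ) :
    ∃ σ : V → L.Term X, ∀ i, ss i = (ts i).subst σ := by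
  choose σs hσs using h
  obtain ⟨σ, hσ, -⟩ := exists_glue (fun i => vars (ts i)) hts σs fun _ => Classical.arbitrary _
  exact ⟨σ, fun i => (hσs i).trans (subst_congr fun x hx => (hσ i x hx).symm)⟩

variable {L' : FirstOrder.Language.{u, v}}

theorem onTerm_subst {X : Type*} (φ : L →ᴸ L') (t : L.Term V) (σ : V → L.Term X) :
    φ.onTerm (t.subst σ) = (φ.onTerm t).subst fun x => φ.onTerm (σ x) := by
  induction t with
  | var x => rfl
  | func f ts ih =>
    simp only [FirstOrder.Language.Term.subst, LHom.onTerm]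
    congr 1
    funext i
    exact ih i

theorem vars_onTerm (φ : L →ᴸ L') (t : L.Term V) : vars (φ.onTerm t) = vars t := by
  induction t with
  | var x => rfl
  | func f ts ih => exact Set.iUnion_congr ih

theorem LinearTerm.onTerm (φ : L →ᴸ L') {t : L.Term V} (ht : LinearTerm t) :
    LinearTerm (φ.onTerm t) := by
  induction t with
  | var x => trivial
  | func f ts ih =>
    refine ⟨fun i => ih i (ht.1 i), fun i j hij => ?_⟩
    simpa only [vars_onTerm] using ht.2 i j hij

theorem vars_plain (t : L.Term V) : vars (plain t) = vars t := vars_onTerm _ t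

theorem plain_func {n : ℕ} (f : L.Functions n) (ts : Fin n → L.Term V) :
    plain (.func f ts) = (.func (Sum.inl f) fun i => plain (ts i) : (Marked L).Term V) := rfl

theorem plain_subst {X : Type*} (t : L.Term V) (σ : V → L.Term X) :
    plain (t.subst σ) = (plain t).subst fun x => plain (σ x) := onTerm_subst _ t σ

/-- The map that erases all marks; it is a left inverse of `plain` that commutes with
substitutions. -/
def unmark {X : Type*} (t : (Marked L).Term X) : L.Term X :=
  (LHom.sumElim (LHom.id L) (LHom.id L)).onTerm t

theorem unmark_subst {X : Type*} (t : (Marked L).Term V) (σ : V → (Marked L).Term X) :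
    unmark (t.subst σ) = (unmark t).subst fun x => unmark (σ x) := onTerm_subst _ t σ

theorem unmark_plain (t : L.Term V) : unmark (plain t) = t := by
  induction t with
  | var x => rfl
  | func f ts ih => exact congrArg _ (funext ih)

theorem plain_eq_subst_iff {X : Type*} (l : L.Term V) (t : L.Term X) :
    (∃ σ, plain t = (plain l).subst σ) ↔ ∃ σ, t = l.subst σ := by
  constructor
  · rintro ⟨σ, hσ⟩
    refine ⟨fun x => unmark (σ x), ?_⟩
    have h := congrArg unmark hσ
    rwa [unmark_subst, unmark_plain, unmark_plain] at h
  · rintro ⟨σ, rfl⟩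
    exact ⟨_, plain_subst l σ⟩

end Terms

/-! ### Rewriting and marking -/

section Rewriting

variable {L : FirstOrder.Language.{u, v}} {V : Type w}

theorem RewritesStar.arg {R : TRS L V} {X : Type*} {n : ℕ} (f : L.Functions n)
    (ts : Fin n → L.Term X) (i : Fin n) {u : L.Term X} (h : RewritesStar R (ts i) u) :
    RewritesStar R (.func f ts) (.func f (Function.update ts i u)) := by
  induction h with
  | refl => rw [Function.update_eq_self]; exact .refl
  | @tail b c _ hbc ih =>
    refine Relation.ReflTransGen.tail ih ?_
    have := Rewrites.arg (R := R) f (Function.update ts i b) i c (by simpa using hbc)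
    simpa using this

theorem RewritesStar.func {R : TRS L V} {X : Type*} {n : ℕ} (f : L.Functions n)
    {ts us : Fin n → L.Term X} (h : ∀ i, RewritesStar R (ts i) (us i)) :
    RewritesStar R (.func f ts) (.func f us) := by
  classical
  have key : ∀ s : Finset (Fin n),
      RewritesStar R (.func f ts) (.func f fun i => if i ∈ s then us i else ts i) := by
    intro s
    induction s using Finset.induction_on with
    | empty => simp only [Finset.notMem_empty, if_false]; exact .refl
    | insert a s ha ih =>
      refine Relation.ReflTransGen.trans ih ?_
      have := RewritesStar.arg (R := R) f (fun i => if i ∈ s then us i else ts i) a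
        (u := us a) (by simpa [ha] using h a)
      have e : (fun i => if i ∈ insert a s then us i else ts i)
          = Function.update (fun i => if i ∈ s then us i else ts i) a (us a) := by
        funext i
        by_cases hi : i = a
        · subst hi; simp
        · simp [hi]
      rwa [e]
  simpa using key Finset.univ

theorem Rewrites.plain {S : TRS L V} {X : Type*} {s t : L.Term X} (h : Rewrites S s t) :
    Rewrites S.plain (CallByNeed.plain s) (CallByNeed.plain t) := by
  induction h with
  | root ρ hρ σ =>
    rw [plain_subst, plain_subst]
    exact Rewrites.root (R := S.plain) ρ.plain ⟨ρ, hρ, rfl⟩ _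
  | arg f ts i u _ ih =>
    have := Rewrites.arg (R := S.plain) (Sum.inl f) (fun i => CallByNeed.plain (ts i)) i _ ih
    rw [plain_func, plain_func]
    convert this using 2
    funext j
    by_cases hj : j = i
    · subst hj; simp
    · simp [hj]

theorem Rewrites.unmark {S : TRS L V} {X : Type*} {s t : (Marked L).Term X}
    (h : Rewrites S.plain s t) : Rewrites S (CallByNeed.unmark s) (CallByNeed.unmark t) := by
  induction h with
  | root ρ hρ σ =>
    obtain ⟨ρ, hρ, rfl⟩ := hρ
    have h := Rewrites.root (R := S) ρ hρ fun x => CallByNeed.unmark (σ x)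
    rw [unmark_subst, unmark_subst]
    change Rewrites S ((CallByNeed.unmark (CallByNeed.plain ρ.lhs)).subst _)
      ((CallByNeed.unmark (CallByNeed.plain ρ.rhs)).subst _)
    rwa [unmark_plain, unmark_plain]
  | @arg n f ts i u _ ih =>
    have h := Rewrites.arg (R := S) (Sum.elim id id f) (fun i => CallByNeed.unmark (ts i)) i _ ih
    have e : ∀ us : Fin n → (Marked L).Term X, CallByNeed.unmark (.func f us)
        = .func (Sum.elim id id f) fun i => CallByNeed.unmark (us i) := by
      intro us
      cases f <;> rfl
    rw [e, e]
    convert h using 2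
    funext j
    by_cases hj : j = i
    · subst hj; simp
    · simp [hj]

theorem isRedex_plain_unmark {S : TRS L V} {X : Type*} {t : (Marked L).Term X}
    (h : IsRedex S.plain t) : IsRedex S (unmark t) := by
  obtain ⟨_, ⟨ρ, hρ, rfl⟩, σ, rfl⟩ := h
  refine ⟨ρ, hρ, fun x => unmark (σ x), ?_⟩
  rw [unmark_subst]
  change (unmark (plain ρ.lhs)).subst _ = _
  rw [unmark_plain]

/-- Root-stability does not change if the signature is enlarged by marked symbols, although these
may be introduced by variables that occur only in right-hand sides. -/
theorem rootStable_plain_iff {S : TRS L V} {X : Type*} (t : L.Term X) :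
    RootStable S.plain (plain t) ↔ RootStable S t := by
  refine not_congr ⟨?_, ?_⟩
  · rintro ⟨u, hu, hr⟩
    refine ⟨unmark u, ?_, isRedex_plain_unmark hr⟩
    have := Relation.ReflTransGen.lift unmark (fun _ _ h => Rewrites.unmark h) _ _ hu
    change RewritesStar S (unmark (plain t)) (unmark u) at this
    rwa [unmark_plain] at this
  · rintro ⟨u, hu, ρ, hρ, σ, rfl⟩
    exact ⟨_, Relation.ReflTransGen.lift plain (fun _ _ h => Rewrites.plain h) _ _ hu,
      ρ.plain, ⟨ρ, hρ, rfl⟩, _, plain_subst _ σ⟩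

/-- `MarksRedex R s u`: the term `u` is obtained from the ground term `s` by marking the root of
one occurrence of a redex of `R`. -/
inductive MarksRedex (R : TRS L V) : L.Term Empty → (Marked L).Term Empty → Prop
  | root {n : ℕ} (f : L.Functions n) (ts : Fin n → L.Term Empty) (h : IsRedex R (.func f ts)) :
      MarksRedex R (.func f ts) (.func (Sum.inr f) fun i => plain (ts i))
  | arg {n : ℕ} (f : L.Functions n) (ts : Fin n → L.Term Empty) (i : Fin n)
      (u : (Marked L).Term Empty) (h : MarksRedex R (ts i) u) :
      MarksRedex R (.func f ts)
        (.func (Sum.inl f) (Function.update (fun j => plain (ts j)) i u))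

theorem marksRedex_fill {R : TRS L V} (C : Context L Empty) {t : L.Term Empty}
    (h : IsRedex R t) : MarksRedex R (C.fill t) (C.plain.fill (markRoot t)) := by
  induction C with
  | hole =>
    cases t with
    | var x => exact x.elim
    | func f ts => exact .root f ts h
  | cons f ts i C ih =>
    have := MarksRedex.arg f (Function.update ts i (C.fill t)) i _ (by simpa using ih)
    have e : (Context.cons f ts i C).plain.fill (markRoot t) = .func (Sum.inl f)
        (Function.update (fun j => plain (Function.update ts i (C.fill t) j)) i
          (C.plain.fill (markRoot t))) := by
      change FirstOrder.Language.Term.func _ _ = _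
      congr 1
      funext j
      by_cases hj : j = i
      · subst hj; simp
      · simp [hj]
    rwa [e]

theorem marksRedex_iff {R : TRS L V} {s : L.Term Empty} {u : (Marked L).Term Empty} :
    MarksRedex R s u ↔ ∃ (C : Context L Empty) (t : L.Term Empty),
      s = C.fill t ∧ IsRedex R t ∧ u = C.plain.fill (markRoot t) := by
  constructor
  · intro h
    induction h with
    | root f ts h => exact ⟨.hole, _, rfl, h, rfl⟩
    | arg f ts i u _ ih =>
      obtain ⟨C, t, hs, ht, rfl⟩ := ih
      exact ⟨.cons f ts i C, t, by simp [Context.fill, ← hs], ht, rfl⟩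
  · rintro ⟨C, t, rfl, ht, rfl⟩
    exact marksRedex_fill C ht

end Rewriting

/-! ### Runs of tree automata -/

section Automata

variable {L : FirstOrder.Language.{u, v}} {Q Q' : Type*}

theorem groundReaches_func_iff {Γ : Set (Transition L Q)} {n : ℕ} {f : L.Functions n}
    {ts : Fin n → L.Term Empty} {q : Q} :
    GroundReaches Γ (.func f ts) q ↔
      ∃ qs : Fin n → Q, (∀ i, GroundReaches Γ (ts i) (qs i)) ∧ ⟨n, f, qs, q⟩ ∈ Γ := by
  constructor
  · intro h
    cases h with
    | func f ts qs q hts hf => exact ⟨qs, hts, hf⟩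
  · rintro ⟨qs, hts, hf⟩
    exact .func f ts qs q hts hf

theorem Reaches.mono {Γ Γ' : Set (Transition L Q)} (h : Γ ⊆ Γ') {X : Type*} {θ : X → Q}
    {t : L.Term X} {q : Q} (ht : Reaches Γ θ t q) : Reaches Γ' θ t q := by
  induction ht with
  | var x => exact .var x
  | func f ts qs q _ hf ih => exact .func f ts qs q ih (h hf)

theorem GroundReaches.mono {Γ Γ' : Set (Transition L Q)} (h : Γ ⊆ Γ') {t : L.Term Empty} {q : Q}
    (ht : GroundReaches Γ t q) : GroundReaches Γ' t q :=
  Reaches.mono h ht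

/-- If the rules of `Γ` whose target lies in the range of `g` are exactly the images of the rules
of `Γ₀`, then the runs of `Γ` that end in this range are the images of the runs of `Γ₀`. -/
theorem groundReaches_map_iff {Γ : Set (Transition L Q')} {Γ₀ : Set (Transition L Q)} {g : Q → Q'}
    (h : ∀ (n : ℕ) (f : L.Functions n) (qs : Fin n → Q') (q : Q),
      ⟨n, f, qs, g q⟩ ∈ Γ ↔ ∃ qs₀ : Fin n → Q, qs = (fun i => g (qs₀ i)) ∧ ⟨n, f, qs₀, q⟩ ∈ Γ₀)
    {t : L.Term Empty} {q : Q} : GroundReaches Γ t (g q) ↔ GroundReaches Γ₀ t q := by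
  induction t generalizing q with
  | var x => exact x.elim
  | func f ts ih =>
    rw [groundReaches_func_iff, groundReaches_func_iff]
    constructor
    · rintro ⟨qs, hts, hf⟩
      obtain ⟨qs₀, rfl, hf₀⟩ := (h _ _ _ _).1 hf
      exact ⟨qs₀, fun i => (ih i).1 (hts i), hf₀⟩
    · rintro ⟨qs₀, hts, hf⟩
      exact ⟨_, fun i => (ih i).2 (hts i), (h _ _ _ _).2 ⟨qs₀, rfl, hf⟩⟩

theorem mem_rules_map_iff {A : TreeAutomaton L Q} {g : Q → Q'} {n : ℕ} {f : L.Functions n}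
    {qs : Fin n → Q'} {q : Q'} :
    ⟨n, f, qs, q⟩ ∈ (A.map g).rules ↔
      ∃ (qs₀ : Fin n → Q) (q₀ : Q),
        qs = (fun i => g (qs₀ i)) ∧ q = g q₀ ∧ ⟨n, f, qs₀, q₀⟩ ∈ A.rules := by
  constructor
  · rintro ⟨⟨n, f, qs₀, q₀⟩, hτ, h⟩
    cases h
    exact ⟨qs₀, q₀, rfl, rfl, hτ⟩
  · rintro ⟨qs₀, q₀, rfl, rfl, h⟩
    exact ⟨_, h, rfl⟩

/-- The set of the states that a ground term reaches. -/
def reachSet (Γ : Set (Transition L Q)) (t : L.Term Empty) : Set Q := {q | GroundReaches Γ t q}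

theorem mem_reachSet {Γ : Set (Transition L Q)} {t : L.Term Empty} {q : Q} :
    q ∈ reachSet Γ t ↔ GroundReaches Γ t q := Iff.rfl

theorem reachSet_func (Γ : Set (Transition L Q)) {n : ℕ} (f : L.Functions n)
    (ts : Fin n → L.Term Empty) :
    reachSet Γ (.func f ts) = down Γ f fun i => reachSet Γ (ts i) :=
  Set.ext fun _ => groundReaches_func_iff

theorem TreeAutomaton.mem_states_of_groundReaches (A : TreeAutomaton L Q) {t : L.Term Empty}
    {q : Q} (h : GroundReaches A.rules t q) : q ∈ A.states :=
  Reaches.mem_states A.rules_over h fun x => x.elim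

theorem TreeAutomaton.groundReaches_complement_iff (A : TreeAutomaton L Q) {t : L.Term Empty}
    {X : Set Q} : GroundReaches A.complement.rules t X ↔ X = reachSet A.rules t := by
  induction t generalizing X with
  | var x => exact x.elim
  | func f ts ih =>
    rw [groundReaches_func_iff, reachSet_func]
    constructor
    · rintro ⟨Xs, hts, -, hX⟩
      have : Xs = fun i => reachSet A.rules (ts i) := funext fun i => (ih i).1 (hts i)
      subst this
      exact hX
    · rintro rfl
      exact ⟨fun i => reachSet A.rules (ts i), fun i => (ih i).2 rfl,
        fun i q hq => A.mem_states_of_groundReaches hq, rfl⟩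

theorem TreeAutomaton.groundReaches_trim_iff (A : TreeAutomaton L Q) {t : L.Term Empty} {q : Q} :
    GroundReaches A.trim.rules t q ↔ GroundReaches A.rules t q := by
  refine ⟨fun h => h.mono (Set.sep_subset _ _), fun h => ?_⟩
  induction t generalizing q with
  | var x => exact x.elim
  | func f ts ih =>
    obtain ⟨qs, hts, hf⟩ := groundReaches_func_iff.1 h
    exact groundReaches_func_iff.2 ⟨qs, fun i => ih i (hts i), hf,
      fun i => ⟨A.mem_states_of_groundReaches (hts i), _, hts i⟩,
      ⟨A.mem_states_of_groundReaches h, _, h⟩⟩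

theorem TreeAutomaton.mem_language_complement_trim_iff (A : TreeAutomaton L Q)
    {t : L.Term Empty} : t ∈ A.complement.trim.language ↔ t ∉ A.language := by
  constructor
  · rintro ⟨X, ⟨⟨-, hX⟩, -⟩, h⟩ ⟨q, hq, hqt⟩
    rw [A.complement.groundReaches_trim_iff, A.groundReaches_complement_iff] at h
    subst h
    exact Set.disjoint_left.1 hX hqt hq
  · intro h
    have hr := (A.groundReaches_complement_iff (t := t)).2 rfl
    exact ⟨reachSet A.rules t, ⟨⟨fun q hq => A.mem_states_of_groundReaches hq,
      Set.disjoint_left.2 fun q hq hqf => h ⟨q, hqf, hq⟩⟩, t, hr⟩,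
      A.complement.groundReaches_trim_iff.2 hr⟩

end Automata

/-! ### The matching automaton -/

section Matching

variable {L : FirstOrder.Language.{u, v}} {V : Type w}

theorem groundReaches_matching_var (R : TRS L V) (x : V) (t : L.Term Empty) :
    GroundReaches (matchingAutomaton R).rules t (cls (.var x)) := by
  induction t with
  | var x => exact x.elim
  | func f ts ih => exact groundReaches_func_iff.2 ⟨_, ih, Or.inr ⟨_, f, x, rfl⟩⟩

theorem groundReaches_matching_subst (R : TRS L V) {t : L.Term V} (ht : t ∈ argSubterms R)
    (σ : V → L.Term Empty) : GroundReaches (matchingAutomaton R).rules (t.subst σ) (cls t) := by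
  induction t with
  | var x => exact groundReaches_matching_var R x _
  | func f ts ih =>
    exact groundReaches_func_iff.2 ⟨fun i => cls (ts i),
      fun i => ih i (arg_mem_argSubterms R ht i), Or.inl ⟨_, f, ts, ht, rfl⟩⟩

/-- A ground term that reaches the state `[t]` is an instance of `t`, provided `t` is linear. -/
theorem exists_subst_of_groundReaches_matching {R : TRS L V} {t : L.Term V} (ht : LinearTerm t)
    {s : L.Term Empty} (h : GroundReaches (matchingAutomaton R).rules s (cls t)) :
    ∃ σ : V → L.Term Empty, s = t.subst σ := by
  induction s generalizing t with
  | var x => exact x.elim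
  | @func n f ss ih =>
    obtain ⟨qs, hss, h⟩ := groundReaches_func_iff.1 h
    obtain ⟨n', f', ts, hmem, h⟩ | ⟨n', f', x, h⟩ := h
    · injection h with h₁ h₂ h₃ h₄
      subst h₁
      obtain rfl := eq_of_heq h₂
      obtain rfl := eq_of_heq h₃
      obtain ⟨π, hπ⟩ := Quotient.exact h₄.symm
      obtain rfl : t = .func f fun i => (ts i).relabel π := hπ
      have : Nonempty (L.Term Empty) := ⟨.func f ss⟩
      obtain ⟨σ, hσ⟩ := exists_subst_of_linear ht.2 (ss := ss) fun i => by
        refine ih i (ht.1 i) ?_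
        have : cls (ts i) = cls ((ts i).relabel π) := Quotient.sound ⟨π, rfl⟩
        rw [← this]
        exact hss i
      exact ⟨σ, congrArg _ (funext hσ)⟩
    · injection h with h₁ h₂ h₃ h₄
      obtain ⟨π, hπ⟩ := Quotient.exact h₄.symm
      obtain rfl : t = .var (π x) := hπ
      exact ⟨fun _ => .func f ss, rfl⟩

theorem groundReaches_matching_iff {R : TRS L V} {t : L.Term V} (ht : LinearTerm t)
    (hmem : t ∈ argSubterms R) {s : L.Term Empty} :
    GroundReaches (matchingAutomaton R).rules s (cls t) ↔
      ∃ σ : V → L.Term Empty, s = t.subst σ := by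
  refine ⟨exists_subst_of_groundReaches_matching ht, ?_⟩
  rintro ⟨σ, rfl⟩
  exact groundReaches_matching_subst R hmem σ

theorem exists_groundReaches_matching [Nonempty (L.Term Empty)] (R : TRS L V)
    {c : TermClass L V} (hc : c ∈ (matchingAutomaton R).states) :
    ∃ t, GroundReaches (matchingAutomaton R).rules t c := by
  obtain ⟨t, ht, rfl⟩ | ⟨x, rfl⟩ := hc
  · exact ⟨_, groundReaches_matching_subst R ht fun _ => Classical.arbitrary _⟩
  · exact ⟨Classical.arbitrary _, groundReaches_matching_var R x _⟩

theorem arg_mem_argSubterms_of_rule {R : TRS L V} {ρ : Rule L V} (hρ : ρ ∈ R.rules)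
    (i : Fin ρ.arity) : ρ.args i ∈ argSubterms R := ⟨ρ, hρ, i, self_mem_subterms _⟩

theorem isRedex_func_iff {R : TRS L V} (hR : R.LeftLinear) {n : ℕ} {f : L.Functions n}
    {ts : Fin n → L.Term Empty} :
    IsRedex R (.func f ts) ↔ ∃ (l : Fin n → L.Term V) (r : L.Term V),
      (⟨n, f, l, r⟩ : Rule L V) ∈ R.rules ∧ ∀ i, ∃ σ : V → L.Term Empty, ts i = (l i).subst σ := by
  constructor
  · rintro ⟨⟨n', f', l, r⟩, hρ, σ, h⟩
    simp only [Rule.lhs, FirstOrder.Language.Term.subst] at h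
    injection h with h₁ h₂ h₃
    subst h₁
    obtain rfl := eq_of_heq h₂
    obtain rfl := eq_of_heq h₃
    exact ⟨l, r, hρ, fun i => ⟨σ, rfl⟩⟩
  · rintro ⟨l, r, hρ, h⟩
    have : Nonempty (L.Term Empty) := ⟨.func f ts⟩
    obtain ⟨σ, hσ⟩ := exists_subst_of_linear (hR _ hρ).2 h
    exact ⟨_, hρ, σ, congrArg _ (funext hσ)⟩

end Matching

/-! ### Saturated automata -/

section Saturation

variable {L : FirstOrder.Language.{u, v}} {V : Type w} {Q : Type*}

theorem Reaches.congr {Γ : Set (Transition L Q)} {X : Type*} {θ θ' : X → Q} {t : L.Term X} {q : Q}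
    (h : Reaches Γ θ t q) (hθ : ∀ x ∈ vars t, θ x = θ' x) : Reaches Γ θ' t q := by
  induction h with
  | var x => rw [hθ x rfl]; exact .var x
  | func f ts qs q _ hf ih =>
    exact .func f ts qs q (fun i => ih i fun x hx => hθ x (Set.mem_iUnion.2 ⟨i, hx⟩)) hf

/-- A run on an instance of a linear term splits into runs on the substituted terms and a run on
the term itself. -/
theorem GroundReaches.exists_of_subst {Γ : Set (Transition L Q)} {t : L.Term V}
    (ht : LinearTerm t) {σ : V → L.Term Empty} {q : Q} (h : GroundReaches Γ (t.subst σ) q) :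
    ∃ θ : V → Q, (∀ x ∈ vars t, GroundReaches Γ (σ x) (θ x)) ∧ Reaches Γ θ t q := by
  induction t generalizing q with
  | var x =>
    refine ⟨fun _ => q, ?_, .var x⟩
    rintro _ rfl
    exact h
  | func f ts ih =>
    obtain ⟨qs, hts, hf⟩ := groundReaches_func_iff.1 h
    choose θs hθs hr using fun i => ih i (ht.1 i) (hts i)
    obtain ⟨θ, hθ, -⟩ := exists_glue (fun i => vars (ts i)) ht.2 θs fun _ => q
    refine ⟨θ, fun x hx => ?_, .func f ts qs q
      (fun i => (hr i).congr fun x hx => (hθ i x hx).symm) hf⟩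
    obtain ⟨i, hi⟩ := Set.mem_iUnion.1 hx
    rw [hθ i x hi]
    exact hθs i x hi

theorem subset_saturation (R : TRS L V) (ι : TermClass L V → Q) (states : Set Q)
    (Γ : Set (Transition L Q)) : Γ ⊆ saturation R ι states Γ :=
  fun _ hτ _ hΓ => hΓ.1 hτ

theorem inferenceClosed_saturation (R : TRS L V) (ι : TermClass L V → Q) (states : Set Q)
    (Γ : Set (Transition L Q)) : InferenceClosed R ι states (saturation R ι states Γ) :=
  fun ρ hρ θ hθ q hq _ hΓ' =>
    hΓ'.2 ρ hρ θ hθ q (hq.mono (Set.sInter_subset_of_mem hΓ'))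

theorem argState_var_of_mem {ι : TermClass L V → Q} {r : L.Term V} {θ : V → Q} {x : V}
    (hx : x ∈ vars r) : argState ι r θ (.var x) = θ x := by
  simp [argState, hx]

theorem argState_of_ne {ι : TermClass L V → Q} {r : L.Term V} {θ : V → Q} {t : L.Term V}
    (ht : ∀ x ∈ vars r, t ≠ .var x) : argState ι r θ t = ι (cls t) := by
  cases t with
  | var x =>
    have hx : x ∉ vars r := fun hx => ht x hx rfl
    simp [argState, hx]
  | func f ts => rfl

/-- The set of terms that reach a given state of a saturated automaton is closed under backward
rewriting. -/
theorem GroundReaches.of_rewrites {R : TRS L V} (hRL : R.RightLinear) {ι : TermClass L V → Q}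
    {A : TreeAutomaton L Q} (hclosed : InferenceClosed R ι A.states A.rules)
    (hι : ∀ (t : L.Term Empty) (c : TermClass L V),
      GroundReaches (matchingAutomaton R).rules t c → GroundReaches A.rules t (ι c))
    {t u : L.Term Empty} (h : Rewrites R t u) {q : Q} (hq : GroundReaches A.rules u q) :
    GroundReaches A.rules t q := by
  induction h generalizing q with
  | root ρ hρ σ =>
    obtain ⟨θ, hσ, hθ⟩ := hq.exists_of_subst (hRL ρ hρ)
    refine groundReaches_func_iff.2 ⟨_, fun i => ?_, hclosed ρ hρ θ
      (fun x hx => A.mem_states_of_groundReaches (hσ x hx)) q hθ⟩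
    by_cases hi : ∃ x ∈ vars ρ.rhs, ρ.args i = .var x
    · obtain ⟨x, hx, hi⟩ := hi
      rw [hi, argState_var_of_mem hx]
      exact hσ x hx
    · rw [argState_of_ne fun x hx h => hi ⟨x, hx, h⟩]
      exact hι _ _ (groundReaches_matching_subst R (arg_mem_argSubterms_of_rule hρ i) σ)
  | arg f ts i u h ih =>
    obtain ⟨qs, hts, hf⟩ := groundReaches_func_iff.1 hq
    refine groundReaches_func_iff.2 ⟨qs, fun j => ?_, hf⟩
    by_cases hj : j = i
    · subst hj
      exact ih (by simpa using hts j)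
    · simpa [hj] using hts j

/-- Saturation adds only runs on terms that rewrite to terms with a run of the given automaton.
This needs that all states are accessible, because the variables that occur only in the right-hand
side of a rule may be mapped to any state. -/
theorem exists_rewritesStar_of_groundReaches_saturation {R : TRS L V} (hLL : R.LeftLinear)
    (hG : R.Growing) {ι : TermClass L V → Q} {states : Set Q} {Γ : Set (Transition L Q)}
    (hinst : ∀ ρ ∈ R.rules, ∀ i, ∀ t : L.Term Empty, GroundReaches Γ t (ι (cls (ρ.args i))) →
      ∃ σ : V → L.Term Empty, t = (ρ.args i).subst σ)
    (hacc : Nonempty (L.Term Empty) → R.rules.Nonempty →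
      ∀ q ∈ states, ∃ t, GroundReaches Γ t q)
    {t : L.Term Empty} {q : Q} (h : GroundReaches (saturation R ι states Γ) t q) :
    ∃ u, RewritesStar R t u ∧ GroundReaches Γ u q := by
  -- The transition rules that are sound for the claim; they form a closed set.
  let Γ' : Set (Transition L Q) := {τ | ∀ ts : Fin τ.arity → L.Term Empty,
    (∀ i, ∃ u, RewritesStar R (ts i) u ∧ GroundReaches Γ u (τ.args i)) →
      ∃ u, RewritesStar R (.func τ.symbol ts) u ∧ GroundReaches Γ u τ.target}
  have hsub : saturation R ι states Γ ⊆ Γ' := by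
    refine Set.sInter_subset_of_mem ⟨?_, ?_⟩
    · rintro ⟨n, f, qs, q⟩ hτ ts hts
      choose us hus hr using hts
      exact ⟨.func f us, RewritesStar.func f hus, groundReaches_func_iff.2 ⟨qs, hr, hτ⟩⟩
    · intro ρ hρ θ hθ q hq
      change ∀ ts : Fin ρ.arity → L.Term Empty, (∀ i, ∃ u, RewritesStar R (ts i) u ∧
        GroundReaches Γ u (argState ι ρ.rhs θ (ρ.args i))) →
          ∃ u, RewritesStar R (.func ρ.root ts) u ∧ GroundReaches Γ u q
      intro ts hts
      have hne : Nonempty (L.Term Empty) := ⟨.func ρ.root ts⟩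
      -- Only the arguments that are not variables of the right-hand side have to be rewritten.
      have hmatch : ∀ i, ∃ (σ : V → L.Term Empty), RewritesStar R (ts i) ((ρ.args i).subst σ) ∧
          ∀ x ∈ vars ρ.rhs, x ∈ vars (ρ.args i) →
            ∃ u, RewritesStar R (σ x) u ∧ GroundReaches Γ u (θ x) := by
        intro i
        by_cases hi : ∃ x ∈ vars ρ.rhs, ρ.args i = .var x
        · obtain ⟨x, hx, hi⟩ := hi
          refine ⟨fun _ => ts i, by rw [hi]; exact .refl, fun y hy hyi => ?_⟩
          rw [hi] at hyi
          obtain rfl : y = x := hyi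
          have := hts i
          rwa [hi, argState_var_of_mem hx] at this
        · obtain ⟨u, hu, hur⟩ := hts i
          rw [argState_of_ne fun x hx h => hi ⟨x, hx, h⟩] at hur
          obtain ⟨σ, rfl⟩ := hinst ρ hρ i u hur
          exact ⟨σ, hu, fun x hx hxi => (hi ⟨x, hx, hG ρ hρ x hx i hxi⟩).elim⟩
      choose σs hσs hvar using hmatch
      have hext : ∀ x, ∃ u : L.Term Empty, x ∈ vars ρ.rhs → GroundReaches Γ u (θ x) := by
        intro x
        by_cases hx : x ∈ vars ρ.rhs
        · obtain ⟨u, hu⟩ := hacc hne ⟨ρ, hρ⟩ _ (hθ x hx)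
          exact ⟨u, fun _ => hu⟩
        · exact ⟨Classical.arbitrary _, fun h => (hx h).elim⟩
      choose σ₀ hσ₀ using hext
      obtain ⟨σ, hσ, hσ'⟩ := exists_glue (fun i => vars (ρ.args i)) (hLL ρ hρ).2 σs σ₀
      have hrhs : ∀ x ∈ vars ρ.rhs, ∃ u, RewritesStar R (σ x) u ∧ GroundReaches Γ u (θ x) := by
        intro x hx
        by_cases hxl : ∃ i, x ∈ vars (ρ.args i)
        · obtain ⟨i, hi⟩ := hxl
          rw [hσ i x hi]
          exact hvar i x hx hi
        · rw [hσ' x fun i hi => hxl ⟨i, hi⟩]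
          exact ⟨_, .refl, hσ₀ x hx⟩
      have hlhs : RewritesStar R (.func ρ.root ts) (ρ.lhs.subst σ) := by
        refine RewritesStar.func ρ.root fun i => ?_
        rw [subst_congr (hσ i)]
        exact hσs i
      have hres : ∃ u, RewritesStar R (ρ.rhs.subst σ) u ∧ GroundReaches Γ u q := by
        generalize ρ.rhs = r at hq hrhs
        induction hq with
        | var x => exact hrhs x rfl
        | func f rs qs q _ hf ih =>
          exact hf _ fun i => ih i fun x hx => hrhs x (Set.mem_iUnion.2 ⟨i, hx⟩)
      obtain ⟨u, hu, hur⟩ := hres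
      exact ⟨u, (hlhs.tail (.root ρ hρ σ)).trans hu, hur⟩
  induction t generalizing q with
  | var x => exact x.elim
  | func f ts ih =>
    obtain ⟨qs, hts, hf⟩ := groundReaches_func_iff.1 h
    exact hsub hf ts fun i => ih i (hts i)

/-- The saturation theorem: for a linear growing `R`, a ground term reaches a state of the
saturated automaton iff it rewrites to a term that reaches this state before saturation. -/
theorem groundReaches_saturate_iff {R : TRS L V} (hLL : R.LeftLinear) (hRL : R.RightLinear)
    (hG : R.Growing) {A : TreeAutomaton L Q} {ι : TermClass L V → Q}
    (hι : ∀ c ∈ (matchingAutomaton R).states, ι c ∈ A.states)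
    (hmatch : ∀ (t : L.Term Empty) (c : TermClass L V),
      GroundReaches A.rules t (ι c) ↔ GroundReaches (matchingAutomaton R).rules t c)
    (hacc : Nonempty (L.Term Empty) → R.rules.Nonempty →
      ∀ q ∈ A.states, ∃ t, GroundReaches A.rules t q)
    {t : L.Term Empty} {q : Q} :
    GroundReaches (A.saturate R ι hι).rules t q ↔
      ∃ u, RewritesStar R t u ∧ GroundReaches A.rules u q := by
  have hsub : A.rules ⊆ (A.saturate R ι hι).rules := subset_saturation R ι A.states A.rules
  constructor
  · refine exists_rewritesStar_of_groundReaches_saturation hLL hG (fun ρ hρ i t ht => ?_) hacc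
    exact exists_subst_of_groundReaches_matching ((hLL ρ hρ).1 i) ((hmatch _ _).1 ht)
  · rintro ⟨u, hu, hq⟩
    induction hu using Relation.ReflTransGen.head_induction_on with
    | refl => exact hq.mono hsub
    | head h _ ih =>
      exact GroundReaches.of_rewrites hRL
        (inferenceClosed_saturation R ι A.states A.rules)
        (fun t c hc => GroundReaches.mono hsub ((hmatch t c).2 hc)) h ih

end Saturation

section Linear

variable {L : FirstOrder.Language.{u, v}} {V : Type w}

/-! ### Linear growing systems -/

/-- Left-linear, right-linear and growing systems, for which saturation is sound and complete. -/
structure TRS.LinearGrowing (R : TRS L V) : Prop where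
  leftLinear : R.LeftLinear
  rightLinear : R.RightLinear
  growing : R.Growing

theorem Rule.plain_growing {ρ : Rule L V}
    (h : ∀ x ∈ vars ρ.rhs, ∀ i, x ∈ vars (ρ.args i) → ρ.args i = .var x) :
    ∀ x ∈ vars (CallByNeed.plain ρ.rhs), ∀ i, x ∈ vars (CallByNeed.plain (ρ.args i)) →
      CallByNeed.plain (ρ.args i) = .var x := by
  intro x hx i hi
  rw [vars_plain] at hx hi
  rw [h x hx i hi]
  rfl

theorem TRS.LinearGrowing.plain {R : TRS L V} (hR : R.LinearGrowing) :
    R.plain.LinearGrowing where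
  leftLinear := by
    rintro _ ⟨ρ, hρ, rfl⟩
    exact (hR.leftLinear ρ hρ).onTerm _
  rightLinear := by
    rintro _ ⟨ρ, hρ, rfl⟩
    exact (hR.rightLinear ρ hρ).onTerm _
  growing := by
    rintro _ ⟨ρ, hρ, rfl⟩
    exact Rule.plain_growing (hR.growing ρ hρ)

theorem TRS.LinearGrowing.circ {R : TRS L V} (hR : R.LinearGrowing) :
    R.circ.LinearGrowing where
  leftLinear := by
    rintro _ (⟨ρ, hρ, rfl⟩ | ⟨ρ, hρ, rfl⟩) <;> exact (hR.leftLinear ρ hρ).onTerm LHom.sumInl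
  rightLinear := by
    rintro _ (⟨ρ, hρ, rfl⟩ | ⟨ρ, hρ, rfl⟩) <;> exact (hR.rightLinear ρ hρ).onTerm _
  growing := by
    rintro _ (⟨ρ, hρ, rfl⟩ | ⟨ρ, hρ, rfl⟩) <;> exact Rule.plain_growing (hR.growing ρ hρ)

theorem IsApproximation.linearGrowing {k : Kind} {R R' : TRS L V} (h : IsApproximation k R R')
    (hR : R.LeftLinear) : R'.LinearGrowing := by
  obtain ⟨⟨φ, hφ, hrules⟩, hg⟩ := h
  have hmem : ∀ ρ' ∈ R'.rules, ∃ ρ ∈ R.rules, ρ' = { ρ with rhs := φ ρ } := by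
    intro ρ' hρ'
    rw [hrules] at hρ'
    obtain ⟨ρ, hρ, rfl⟩ := hρ'
    exact ⟨ρ, hρ, rfl⟩
  have hLL : R'.LeftLinear := by
    intro ρ' hρ'
    obtain ⟨ρ, hρ, rfl⟩ := hmem ρ' hρ'
    exact hR ρ hρ
  cases k with
  | g => exact ⟨hLL, (hg rfl).1, (hg rfl).2⟩
  | s =>
    refine ⟨hLL, fun ρ' hρ' => ?_, fun ρ' hρ' x hx i hi => ?_⟩
    all_goals
      obtain ⟨ρ, hρ, rfl⟩ := hmem ρ' hρ'
      obtain ⟨y, hy, hr⟩ := hφ ρ hρ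
    · change LinearTerm (φ ρ)
      rw [hr]
      trivial
    · change x ∈ vars (φ ρ) at hx
      rw [hr] at hx
      obtain rfl : x = y := hx
      exact (hy (Set.mem_iUnion.2 ⟨i, hi⟩)).elim
  | nv =>
    refine ⟨hLL, fun ρ' hρ' => ?_, fun ρ' hρ' x hx i hi => ?_⟩
    all_goals
      obtain ⟨ρ, hρ, rfl⟩ := hmem ρ' hρ'
      obtain ⟨-, hlin, hdisj⟩ := hφ ρ hρ
    · exact hlin
    · exact (Set.disjoint_left.1 hdisj hx (Set.mem_iUnion.2 ⟨i, hi⟩)).elim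

/-! ### The automata for root-stability -/

theorem groundReaches_redexAutomaton_some (S : TRS L V) (t : L.Term Empty) (c : TermClass L V) :
    GroundReaches (redexAutomaton S).rules t (some c) ↔
      GroundReaches (matchingAutomaton S).rules t c := by
  refine groundReaches_map_iff fun n f qs q => ?_
  constructor
  · rintro (h | ⟨ρ, -, h⟩)
    · obtain ⟨qs₀, q₀, hqs, hq, h⟩ := mem_rules_map_iff.1 h
      cases hq
      exact ⟨qs₀, hqs, h⟩
    · injection h with _ _ _ h
      cases h
  · rintro ⟨qs₀, rfl, h⟩
    exact Or.inl (mem_rules_map_iff.2 ⟨qs₀, q, rfl, rfl, h⟩)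

theorem groundReaches_redexAutomaton_none {S : TRS L V} (hS : S.LeftLinear) (t : L.Term Empty) :
    GroundReaches (redexAutomaton S).rules t none ↔ IsRedex S t := by
  cases t with
  | var x => exact x.elim
  | func f ts =>
    rw [groundReaches_func_iff, isRedex_func_iff hS]
    constructor
    · rintro ⟨qs, hts, h | ⟨⟨n', f', l, r⟩, hρ, h⟩⟩
      · obtain ⟨-, q₀, -, hq, -⟩ := mem_rules_map_iff.1 h
        cases hq
      · cases h
        exact ⟨l, r, hρ, fun i => exists_subst_of_groundReaches_matching ((hS _ hρ).1 i)
          ((groundReaches_redexAutomaton_some S _ _).1 (hts i))⟩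
    · rintro ⟨l, r, hρ, h⟩
      refine ⟨fun i => some (cls (l i)), fun i => ?_, Or.inr ⟨_, hρ, rfl⟩⟩
      obtain ⟨σ, hσ⟩ := h i
      rw [groundReaches_redexAutomaton_some, hσ]
      exact groundReaches_matching_subst S (arg_mem_argSubterms_of_rule hρ i) σ

theorem mem_language_nonRootStableAutomaton_iff {S : TRS L V} (hS : S.LinearGrowing)
    (t : L.Term Empty) : t ∈ (nonRootStableAutomaton S).language ↔ ¬ RootStable S t := by
  have key : ∀ u, GroundReaches (nonRootStableAutomaton S).rules t u ↔
      ∃ u', RewritesStar S t u' ∧ GroundReaches (redexAutomaton S).rules u' u := by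
    intro u
    refine groundReaches_saturate_iff hS.leftLinear hS.rightLinear hS.growing _
      (groundReaches_redexAutomaton_some S) ?_
    rintro hne ⟨ρ, hρ⟩ _ (rfl | ⟨c, hc, rfl⟩)
    · exact ⟨_, (groundReaches_redexAutomaton_none hS.leftLinear _).2
        ⟨ρ, hρ, fun _ => Classical.arbitrary _, rfl⟩⟩
    · obtain ⟨s, hs⟩ := exists_groundReaches_matching S hc
      exact ⟨s, (groundReaches_redexAutomaton_some S _ _).2 hs⟩
  unfold RootStable
  rw [not_not]
  constructor
  · rintro ⟨_, rfl, h⟩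
    obtain ⟨u, hu, hr⟩ := (key _).1 h
    exact ⟨u, hu, (groundReaches_redexAutomaton_none hS.leftLinear _).1 hr⟩
  · rintro ⟨u, hu, hr⟩
    exact ⟨_, rfl, (key _).2 ⟨u, hu, (groundReaches_redexAutomaton_none hS.leftLinear _).2 hr⟩⟩

theorem mem_language_rootStableAutomaton_iff {S : TRS L V} (hS : S.LinearGrowing)
    (t : L.Term Empty) : t ∈ (rootStableAutomaton S).language ↔ RootStable S t := by
  rw [rootStableAutomaton, TreeAutomaton.mem_language_complement_trim_iff,
    mem_language_nonRootStableAutomaton_iff hS, not_not]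

section Union

variable {Q : Type*}

theorem groundReaches_union_inl (A : TreeAutomaton L Q) (R : TRS L V) (t : L.Term Empty) (q : Q) :
    GroundReaches ((A.map Sum.inl).union ((matchingAutomaton R).map Sum.inr)).rules t (.inl q) ↔
      GroundReaches A.rules t q := by
  refine groundReaches_map_iff fun n f qs q => ?_
  constructor
  · rintro (h | h)
    · obtain ⟨qs₀, q₀, hqs, hq, h⟩ := mem_rules_map_iff.1 h
      cases hq
      exact ⟨qs₀, hqs, h⟩
    · obtain ⟨qs₀, q₀, hqs, hq, h⟩ := mem_rules_map_iff.1 h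
      cases hq
  · rintro ⟨qs₀, rfl, h⟩
    exact Or.inl (mem_rules_map_iff.2 ⟨qs₀, q, rfl, rfl, h⟩)

theorem groundReaches_union_inr (A : TreeAutomaton L Q) (R : TRS L V) (t : L.Term Empty)
    (c : TermClass L V) :
    GroundReaches ((A.map Sum.inl).union ((matchingAutomaton R).map Sum.inr)).rules t (.inr c) ↔
      GroundReaches (matchingAutomaton R).rules t c := by
  refine groundReaches_map_iff fun n f qs q => ?_
  constructor
  · rintro (h | h)
    · obtain ⟨qs₀, q₀, hqs, hq, h⟩ := mem_rules_map_iff.1 h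
      cases hq
    · obtain ⟨qs₀, q₀, hqs, hq, h⟩ := mem_rules_map_iff.1 h
      cases hq
      exact ⟨qs₀, hqs, h⟩
  · rintro ⟨qs₀, rfl, h⟩
    exact Or.inr (mem_rules_map_iff.2 ⟨qs₀, q, rfl, rfl, h⟩)

theorem mem_language_saturatedUnion_iff {A : TreeAutomaton L Q} {R : TRS L V}
    (hR : R.LinearGrowing) (hA : ∀ q ∈ A.states, ∃ t, GroundReaches A.rules t q)
    {t : L.Term Empty} :
    t ∈ (saturatedUnion A R).language ↔ ∃ u, RewritesStar R t u ∧ u ∈ A.language := by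
  have key : ∀ q, GroundReaches (saturatedUnion A R).rules t q ↔
      ∃ u, RewritesStar R t u ∧
        GroundReaches ((A.map Sum.inl).union ((matchingAutomaton R).map Sum.inr)).rules u q := by
    intro q
    refine groundReaches_saturate_iff hR.leftLinear hR.rightLinear hR.growing _
      (groundReaches_union_inr A R) ?_
    rintro hne - _ (⟨q, hq, rfl⟩ | ⟨c, hc, rfl⟩)
    · obtain ⟨s, hs⟩ := hA q hq
      exact ⟨s, (groundReaches_union_inl A R s q).2 hs⟩
    · obtain ⟨s, hs⟩ := exists_groundReaches_matching R hc
      exact ⟨s, (groundReaches_union_inr A R s c).2 hs⟩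
  constructor
  · rintro ⟨_, ⟨q, hq, rfl⟩ | ⟨c, hc, rfl⟩, h⟩
    · obtain ⟨u, hu, hr⟩ := (key _).1 h
      exact ⟨u, hu, q, hq, (groundReaches_union_inl A R u q).1 hr⟩
    · exact hc.elim
  · rintro ⟨u, hu, q, hq, hr⟩
    exact ⟨_, Or.inl ⟨q, hq, rfl⟩, (key _).2 ⟨u, hu, (groundReaches_union_inl A R u q).2 hr⟩⟩

end Union

theorem mem_language_toRootStableAutomaton_iff {R S : TRS L V} (hR : R.LinearGrowing)
    (hS : S.LinearGrowing) (t : (Marked L).Term Empty) :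
    t ∈ (toRootStableAutomaton R S).language ↔
      ∃ u, RewritesStar R.plain t u ∧ RootStable S.circ u := by
  unfold toRootStableAutomaton
  rw [mem_language_saturatedUnion_iff hR.plain]
  · simp only [mem_language_rootStableAutomaton_iff hS.circ]
  · rintro q ⟨-, s, hs⟩
    exact ⟨s, (TreeAutomaton.groundReaches_trim_iff _).2 hs⟩

/-! ### The components of the automaton `C'` -/

theorem mem_rules_automatonC'_iff {R S : TRS L V} {τ : Transition (Marked L) (StateC' L V)} :
    τ ∈ (automatonC' R S).rules ↔
      τ ∈ ((toRootStableAutomaton R S).map Sum.inl).rules ∨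
      τ ∈ ((matchingAutomaton R.plain).map (Sum.inr ∘ Sum.inl)).rules ∨
      τ ∈ ((nonRootStableAutomaton S.plain).withoutFinal.map (Sum.inr ∘ Sum.inr)).rules := Iff.rfl

theorem groundReaches_automatonC'_inl (R S : TRS L V) (t : (Marked L).Term Empty) (q) :
    GroundReaches (automatonC' R S).rules t (.inl q) ↔
      GroundReaches (toRootStableAutomaton R S).rules t q := by
  refine groundReaches_map_iff fun n f qs q => ?_
  rw [mem_rules_automatonC'_iff, mem_rules_map_iff, mem_rules_map_iff, mem_rules_map_iff]
  constructor
  · rintro (⟨qs₀, q₀, hqs, hq, h⟩ | ⟨qs₀, q₀, hqs, hq, h⟩ | ⟨qs₀, q₀, hqs, hq, h⟩) <;> cases hq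
    exact ⟨qs₀, hqs, h⟩
  · rintro ⟨qs₀, rfl, h⟩
    exact Or.inl ⟨qs₀, q, rfl, rfl, h⟩

theorem groundReaches_automatonC'_matching (R S : TRS L V) (t : (Marked L).Term Empty) (c) :
    GroundReaches (automatonC' R S).rules t (.inr (.inl c)) ↔
      GroundReaches (matchingAutomaton R.plain).rules t c := by
  refine groundReaches_map_iff (g := Sum.inr ∘ Sum.inl) fun n f qs q => ?_
  rw [mem_rules_automatonC'_iff, mem_rules_map_iff, mem_rules_map_iff, mem_rules_map_iff]
  constructor
  · rintro (⟨qs₀, q₀, hqs, hq, h⟩ | ⟨qs₀, q₀, hqs, hq, h⟩ | ⟨qs₀, q₀, hqs, hq, h⟩) <;> cases hq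
    exact ⟨qs₀, hqs, h⟩
  · rintro ⟨qs₀, rfl, h⟩
    exact Or.inr (Or.inl ⟨qs₀, q, rfl, rfl, h⟩)

theorem groundReaches_automatonC'_redex (R S : TRS L V) (t : (Marked L).Term Empty) (q) :
    GroundReaches (automatonC' R S).rules t (.inr (.inr q)) ↔
      GroundReaches (nonRootStableAutomaton S.plain).rules t q := by
  refine groundReaches_map_iff (g := Sum.inr ∘ Sum.inr) fun n f qs q => ?_
  rw [mem_rules_automatonC'_iff, mem_rules_map_iff, mem_rules_map_iff, mem_rules_map_iff]
  constructor
  · rintro (⟨qs₀, q₀, hqs, hq, h⟩ | ⟨qs₀, q₀, hqs, hq, h⟩ | ⟨qs₀, q₀, hqs, hq, h⟩) <;> cases hq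
    exact ⟨qs₀, hqs, h⟩
  · rintro ⟨qs₀, rfl, h⟩
    exact Or.inr (Or.inr ⟨qs₀, q, rfl, rfl, h⟩)

theorem reachSet_inter_finalREDEX_iff {R S : TRS L V} (hS : S.LinearGrowing) (t : L.Term Empty) :
    (reachSet (automatonC' R S).rules (plain t) ∩ finalREDEX S).Nonempty ↔ ¬ RootStable S t := by
  rw [← rootStable_plain_iff, ← mem_language_nonRootStableAutomaton_iff hS.plain]
  constructor
  · rintro ⟨_, h, q, hq, rfl⟩
    exact ⟨q, hq, (groundReaches_automatonC'_redex R S _ q).1 h⟩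
  · rintro ⟨q, hq, h⟩
    exact ⟨_, (groundReaches_automatonC'_redex R S _ q).2 h, q, hq, rfl⟩

theorem exists_mem_finalRS_iff {R S : TRS L V} (hR : R.LinearGrowing) (hS : S.LinearGrowing)
    (u : (Marked L).Term Empty) :
    (∃ q ∈ finalRS R S, GroundReaches (automatonC' R S).rules u q) ↔
      ∃ t, RootStable S.circ t ∧ RewritesStar R.plain u t := by
  have h := mem_language_toRootStableAutomaton_iff hR hS u
  simp only [and_comm (a := RootStable S.circ _)]
  rw [← h]
  constructor
  · rintro ⟨_, ⟨q, hq, rfl⟩, hu⟩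
    exact ⟨q, hq, (groundReaches_automatonC'_inl R S u q).1 hu⟩
  · rintro ⟨q, hq, hu⟩
    exact ⟨_, ⟨q, hq, rfl⟩, (groundReaches_automatonC'_inl R S u q).2 hu⟩

theorem matchesLhs_reachSet_iff {R S : TRS L V} (hR : R.LeftLinear) {n : ℕ} (f : L.Functions n)
    (ts : Fin n → L.Term Empty) :
    MatchesLhs R f (fun i => reachSet (automatonC' R S).rules (plain (ts i))) ↔
      IsRedex R (.func f ts) := by
  rw [isRedex_func_iff hR]
  refine exists_congr fun l => exists_congr fun r => and_congr_right fun hρ =>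
    forall_congr' fun i => ?_
  have hmem : plain (l i) ∈ argSubterms R.plain :=
    arg_mem_argSubterms_of_rule (R := R.plain) ⟨_, hρ, rfl⟩ i
  have hlin : LinearTerm (plain (l i)) := ((hR _ hρ).1 i).onTerm _
  rw [← plain_eq_subst_iff, ← groundReaches_matching_iff hlin hmem]
  exact groundReaches_automatonC'_matching R S _ _

/-! ### The automaton `D'` -/

/-- In a state `[S, P]` that a ground term reaches, `S` consists of the states that the term
reaches, and for every redex of the term, marking it gives a term that reaches a state in `P`. -/
theorem of_groundReaches_automatonD' {R S : TRS L V} (hR : R.LeftLinear) {t : L.Term Empty}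
    {X : Set (StateC' L V) × Set (StateC' L V)} (h : GroundReaches (automatonD' R S).rules t X) :
    X.1 = reachSet (automatonC' R S).rules (plain t) ∧
      ∀ u, MarksRedex R t u → ∃ q ∈ X.2, GroundReaches (automatonC' R S).rules u q := by
  induction t generalizing X with
  | var x => exact x.elim
  | func f ts ih =>
    obtain ⟨qs, hts, hf⟩ := groundReaches_func_iff.1 h
    change IsTransitionD' R S _ at hf
    cases hf with
    | mk _ Ss Ps P₁ P₂ hSs hPs hP₁ hP₁' hP₂ hP₂' =>
      obtain rfl : Ss = fun i => reachSet (automatonC' R S).rules (plain (ts i)) :=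
        funext fun i => (ih i (hts i)).1
      refine ⟨(reachSet_func _ (L := Marked L) (Sum.inl f) _).symm, fun u hu => ?_⟩
      cases hu with
      | root _ _ hr =>
        obtain ⟨⟨q, hq⟩, hsub⟩ := hP₂ ((matchesLhs_reachSet_iff hR f ts).2 hr)
        exact ⟨q, Or.inr hq, groundReaches_func_iff.2 (hsub hq)⟩
      | arg _ _ i u hu =>
        obtain ⟨q', hq', hr⟩ := (ih i (hts i)).2 u hu
        obtain ⟨q, hq, qs, hqs, hf⟩ := hP₁' i q' hq'
        refine ⟨q, Or.inl hq, groundReaches_func_iff.2 ⟨qs, fun j => ?_, hf⟩⟩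
        have := hqs j
        by_cases hj : j = i
        · subst hj
          simp only [Function.update_self, Set.mem_singleton_iff] at this ⊢
          exact this ▸ hr
        · simpa [hj, mem_reachSet] using this

/-- Every set `P` that meets the states reached after marking any redex, and that consists of such
states, is the second component of a state that the term reaches. -/
theorem groundReaches_automatonD' {R S : TRS L V} (hR : R.LeftLinear) {t : L.Term Empty}
    {P : Set (StateC' L V)}
    (hP : ∀ q ∈ P, ∃ u, MarksRedex R t u ∧ GroundReaches (automatonC' R S).rules u q)
    (hP' : ∀ u, MarksRedex R t u → ∃ q ∈ P, GroundReaches (automatonC' R S).rules u q) :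
    GroundReaches (automatonD' R S).rules t (reachSet (automatonC' R S).rules (plain t), P) := by
  induction t generalizing P with
  | var x => exact x.elim
  | @func n f ts ih =>
    set Γ := (automatonC' R S).rules with hΓ
    let Ss : Fin n → Set (StateC' L V) := fun i => reachSet Γ (plain (ts i))
    let Ps : Fin n → Set (StateC' L V) := fun i =>
      {q' | (∃ u, MarksRedex R (ts i) u ∧ GroundReaches Γ u q') ∧
        (P ∩ down Γ (Sum.inl f) (Function.update Ss i {q'})).Nonempty}
    -- A run on a term with a marked redex in the `i`-th argument passes through a state in `Ps i`.
    have hrun : ∀ i u q, q ∈ P → MarksRedex R (ts i) u →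
        GroundReaches Γ (.func (Sum.inl f) (Function.update (fun j => plain (ts j)) i u)) q →
        ∃ q' ∈ Ps i, GroundReaches Γ u q' ∧
          q ∈ down Γ (Sum.inl f) (Function.update Ss i {q'}) := by
      intro i u q hq hu hr
      obtain ⟨qs, hqs, hf⟩ := groundReaches_func_iff.1 hr
      have hqi : GroundReaches Γ u (qs i) := by simpa using hqs i
      have hd : q ∈ down Γ (Sum.inl f) (Function.update Ss i {qs i}) := by
        refine ⟨qs, fun j => ?_, hf⟩
        by_cases hj : j = i
        · subst hj; simp
        · simpa [hj, Ss, mem_reachSet] using hqs j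
      exact ⟨qs i, ⟨⟨u, hu, hqi⟩, q, hq, hd⟩, hqi, hd⟩
    have hdown : ∀ i, ∀ q' ∈ Ps i, down Γ (Sum.inl f) (Function.update Ss i {q'}) ⊆
        down Γ (Sum.inl f) (Function.update Ss i (Ps i)) := by
      rintro i q' hq' q ⟨qs, hqs, hf⟩
      refine ⟨qs, fun j => ?_, hf⟩
      have := hqs j
      by_cases hj : j = i
      · subst hj
        simp only [Function.update_self, Set.mem_singleton_iff] at this ⊢
        exact this ▸ hq'
      · simpa [hj] using this
    have hargs : ∀ i, GroundReaches (automatonD' R S).rules (ts i) (Ss i, Ps i) := by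
      refine fun i => ih i (fun q' hq' => hq'.1) fun u hu => ?_
      obtain ⟨q, hq, hr⟩ := hP' _ (.arg f ts i u hu)
      obtain ⟨q', hq', hr', -⟩ := hrun i u q hq hu hr
      exact ⟨q', hq', hr'⟩
    let P₁ : Set (StateC' L V) :=
      P ∩ ⋃ i, down Γ (Sum.inl f) (Function.update Ss i (Ps i))
    let P₂ : Set (StateC' L V) :=
      {q ∈ P | IsRedex R (.func f ts) ∧ q ∈ down Γ (Sum.inr f) Ss}
    have hPeq : P = P₁ ∪ P₂ := by
      refine Set.Subset.antisymm (fun q hq => ?_)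
        (Set.union_subset Set.inter_subset_left (Set.sep_subset _ _))
      obtain ⟨u, hu, hr⟩ := hP q hq
      cases hu with
      | root _ _ hredex => exact Or.inr ⟨hq, hredex, groundReaches_func_iff.1 hr⟩
      | arg _ _ i u hu =>
        obtain ⟨q', hq', -, hd⟩ := hrun i u q hq hu hr
        exact Or.inl ⟨hq, Set.mem_iUnion.2 ⟨i, hdown i q' hq' hd⟩⟩
    have hS : reachSet Γ (plain (.func f ts)) = down Γ (Sum.inl f) Ss :=
      reachSet_func Γ (L := Marked L) (Sum.inl f) _
    rw [hS, hPeq]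
    refine groundReaches_func_iff.2 ⟨fun i => (Ss i, Ps i), hargs,
      IsTransitionD'.mk f Ss Ps P₁ P₂ ?_ ?_ Set.inter_subset_right ?_ ?_ ?_⟩
    · exact fun i q hq => (automatonC' R S).mem_states_of_groundReaches hq
    · rintro i q ⟨⟨u, -, hu⟩, -⟩
      exact (automatonC' R S).mem_states_of_groundReaches hu
    · rintro i q' hq'
      obtain ⟨q, hq, hd⟩ := hq'.2
      exact ⟨q, ⟨hq, Set.mem_iUnion.2 ⟨i, hdown i q' hq' hd⟩⟩, hd⟩
    · intro hm
      have hredex := (matchesLhs_reachSet_iff hR f ts).1 hm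
      obtain ⟨q, hq, hr⟩ := hP' _ (.root f ts hredex)
      exact ⟨⟨q, hq, hredex, groundReaches_func_iff.1 hr⟩, fun q hq => hq.2.2⟩
    · intro hm
      refine Set.eq_empty_iff_forall_notMem.2 fun q hq => hm ?_
      exact (matchesLhs_reachSet_iff hR f ts).2 hq.2.1

/-- The automaton `D'` accepts exactly the ground terms that are not root-stable and in which no
redex is root-needed. -/
theorem mem_language_automatonD'_iff {R S : TRS L V} (hR : R.LinearGrowing)
    (hS : S.LinearGrowing) (t : L.Term Empty) :
    t ∈ (automatonD' R S).language ↔ ¬ RootStable S t ∧ ∀ u, MarksRedex R t u →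
      ∃ v, RootStable S.circ v ∧ RewritesStar R.plain u v := by
  constructor
  · rintro ⟨X, ⟨-, hX₁, hX₂⟩, h⟩
    obtain ⟨hS', hP⟩ := of_groundReaches_automatonD' hR.leftLinear h
    rw [hS', reachSet_inter_finalREDEX_iff hS] at hX₁
    refine ⟨hX₁, fun u hu => (exists_mem_finalRS_iff hR hS u).1 ?_⟩
    obtain ⟨q, hq, hr⟩ := hP u hu
    exact ⟨q, hX₂ hq, hr⟩
  · rintro ⟨ht, hu⟩
    refine ⟨(reachSet (automatonC' R S).rules (plain t), _),
      ⟨fun q hq => (automatonC' R S).mem_states_of_groundReaches hq,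
      (reachSet_inter_finalREDEX_iff (R := R) hS t).2 ht, ?_⟩,
      groundReaches_automatonD' hR.leftLinear
        (P := {q ∈ finalRS R S |
          ∃ u, MarksRedex R t u ∧ GroundReaches (automatonC' R S).rules u q})
        (fun q hq => hq.2) fun u hm => ?_⟩
    · exact Set.sep_subset _ _
    · obtain ⟨q, hq, hr⟩ := (exists_mem_finalRS_iff hR hS u).2 (hu u hm)
      exact ⟨q, ⟨hq, u, hm, hr⟩, hr⟩

end Linear
end CallByNeed

/-- For a left-linear term rewriting system `R` and approximation mappings `α`, `β` of the kinds
`s`, `nv` or `g`, we have `R ∈ CBN-RS` for `α`, `β` iff the language of `D'(α R, β R)` is empty. -/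
theorem mainTheorem4 {L : FirstOrder.Language.{u, v}} {V : Type w} [Infinite V]
    (a b : CallByNeed.Kind) (α β : CallByNeed.TRS L V → CallByNeed.TRS L V)
    (hα : CallByNeed.IsApproximationMapping a α) (hβ : CallByNeed.IsApproximationMapping b β)
    (R : CallByNeed.TRS L V) (hR : R.LeftLinear) :
    R ∈ CallByNeed.CBNRS α β ↔ (CallByNeed.automatonD' (α R) (β R)).language = ∅ := by
  rw [Set.eq_empty_iff_forall_notMem]
  refine forall_congr' fun s => ?_
  rw [CallByNeed.mem_language_automatonD'_iff ((hα R).linearGrowing hR)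
    ((hβ R).linearGrowing hR), not_and]
  refine imp_congr_right fun _ => ?_
  push Not
  constructor
  · rintro ⟨C, t, hs, ht, hneeded⟩
    refine ⟨_, CallByNeed.marksRedex_iff.2 ⟨C, t, hs, ht, rfl⟩, fun v hv hr => ?_⟩
    exact hneeded ⟨v, hv, hr⟩
  · rintro ⟨u, hu, hneeded⟩
    obtain ⟨C, t, hs, ht, rfl⟩ := CallByNeed.marksRedex_iff.1 hu
    exact ⟨C, t, hs, ht, fun ⟨v, hv, hr⟩ => hneeded v hv hr⟩
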